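/- Let $k$ be a field of characteristic different from $2$ and $3$, let $\Gamma$ be a commutative group, and let $\varepsilon:\Gamma\times\Gamma\to k\setminus\{0\}$ be a commutation factor, i.e. $\varepsilon$ is bimultiplicative and $\varepsilon(\alpha,\beta)\varepsilon(\beta,\alpha)=1$. Let $g=\bigoplus_{\gamma\in\Gamma}g_\gamma$ be a finite-dimensional abelian color Lie algebra (a $\Gamma$-graded $\varepsilon$-Lie algebra with zero bracket) over $k$. Let $U(g)$ be its universal enveloping algebra, i.e. the quotient of the tensor algebra $T(g)$ by the relations $ab-\varepsilon(\alpha,\beta)ba=0$ for $a\in g_\alpha$, $b\in g_\beta$, with the augmentation $U(g)\to k$ that sends $g$ to $0$ and with the $\mathbb{Z}_{\ge 0}$-grading in which $g$ has degree $1$. Let $W$ be a set of homogeneous elements of $g$ (for instance a subset of a homogeneous basis of $g$), let $W\,U(g)$ be the right ideal generated by $W$, and let $M=U(g)/W\,U(g)$ be the cyclic graded right $U(g)$-module. Put $H_i(g,M)=\operatorname{Tor}_i^{U(g)}(M,k)$, with the grading $H_i(g,M)=\bigoplus_j H_i(g,M)_j$ induced by the gradings of $U(g)$ and $M$. Then for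 every $i\ge 0$ the graded vector space $H_i(g,M)$ is concentrated in degree $i$, i.e. $H_i(g,M)_j=0$ for all $j\ne i$. In other words, $U(g)$ is a standard graded algebra (connected, generated in degree one, with finite-dimensional components) and $M$ is a Koszul module over it, generated in degree $0$. -/

import Mathlib

open scoped TensorProduct DirectSum
open MulOpposite

universe u v w

noncomputable section

/-! ### Color Lie algebras -/

/-- A commutation factor on the commutative group `Γ` with values in `k \ {0}`. -/
structure CommutationFactor (Γ : Type w) (k : Type u) [AddCommGroup Γ] [Field k] where
  toFun : Γ → Γ → kˣ
  add_left : ∀ α β γ, toFun (α + β) γ = toFun α γ * toFun β γ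
  add_right : ∀ α β γ, toFun α (β + γ) = toFun α β * toFun α γ
  skew : ∀ α β, toFun α β * toFun β α = 1

/-- A `Γ`-graded `ε`-Lie algebra (color Lie algebra) structure on the `k`-vector space `g`. -/
structure ColorLieAlgebra {Γ : Type w} {k : Type u} [AddCommGroup Γ] [DecidableEq Γ] [Field k]
    (ε : CommutationFactor Γ k) (g : Type v) [AddCommGroup g] [Module k g] where
  /-- the homogeneous components of `g` -/
  comp : Γ → Submodule k g
  isInternal : DirectSum.IsInternal comp
  bracket : g →ₗ[k] g →ₗ[k] g
  bracket_mem : ∀ α β, ∀ a ∈ comp α, ∀ b ∈ comp β, bracket a b ∈ comp (α + β)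
  bracket_skew : ∀ α β, ∀ a ∈ comp α, ∀ b ∈ comp β,
    bracket a b = -((ε.toFun α β : k) • bracket b a)
  jacobi : ∀ α β γ, ∀ a ∈ comp α, ∀ b ∈ comp β, ∀ c ∈ comp γ,
    (ε.toFun γ α : k) • bracket a (bracket b c) + (ε.toFun β γ : k) • bracket c (bracket a b)
      + (ε.toFun α β : k) • bracket b (bracket c a) = 0

namespace ColorLieAlgebra

variable {Γ : Type w} {k : Type u} [AddCommGroup Γ] [DecidableEq Γ] [Field k]
  {ε : CommutationFactor Γ k} {g : Type v} [AddCommGroup g] [Module k g]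
  (L : ColorLieAlgebra ε g)

/-- `g` is abelian: the bracket vanishes. -/
def IsAbelian : Prop := ∀ a b : g, L.bracket a b = 0

/-- `a` is homogeneous: it lies in one of the components. -/
def IsHomogeneous (a : g) : Prop := ∃ γ, a ∈ L.comp γ

/-- The relations `a b - ε(α, β) b a = ⟨a, b⟩` for homogeneous `a`, `b` of degrees `α`, `β`. -/
inductive Rel : TensorAlgebra k g → TensorAlgebra k g → Prop
  | mk (α β : Γ) (a b : g) (ha : a ∈ L.comp α) (hb : b ∈ L.comp β) :
      Rel (TensorAlgebra.ι k a * TensorAlgebra.ι k b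
            - (ε.toFun α β : k) • (TensorAlgebra.ι k b * TensorAlgebra.ι k a))
          (TensorAlgebra.ι k (L.bracket a b))

/-- The universal enveloping algebra `U(g)`. -/
abbrev UEA : Type (max u v) := RingQuot L.Rel

/-- The canonical map `g → U(g)`. -/
def ι : g →ₗ[k] L.UEA :=
  (RingQuot.mkAlgHom k L.Rel).toLinearMap ∘ₗ TensorAlgebra.ι k

/-- The augmentation `U(g) → k`, which sends `g` to `0`. -/
def aug : L.UEA →ₐ[k] k :=
  RingQuot.liftAlgHom k ⟨TensorAlgebra.lift k (0 : g →ₗ[k] k), by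
    rintro _ _ ⟨α, β, a, b, ha, hb⟩
    simp⟩

/-- The degree `n` part of `U(g)`: the span of the products of `n` elements of `g`.
For abelian `g` the relations are homogeneous, and these are the components of a grading. -/
def ueaDeg (n : ℕ) : Submodule k L.UEA := LinearMap.range L.ι ^ n

/-- The right ideal `W U(g)`. -/
abbrev rightIdeal (W : Set g) : Submodule (L.UEA)ᵐᵒᵖ L.UEA :=
  Submodule.span (L.UEA)ᵐᵒᵖ (L.ι '' W)

/-- The cyclic right module `U(g) / W U(g)`. -/
abbrev CyclicModule (W : Set g) : Type (max u v) := L.UEA ⧸ L.rightIdeal W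

/-- The grading of `U(g) / W U(g)` induced from `U(g)`. -/
def cyclicDeg (W : Set g) (n : ℕ) : Submodule k (L.CyclicModule W) :=
  (L.ueaDeg n).map ((L.rightIdeal W).mkQ.restrictScalars k)

end ColorLieAlgebra

/-! ### The graded vector spaces `Tor_i^R(M, k)`

`R` is an augmented `k`-algebra and `M` a right `R`-module (a module over `Rᵐᵒᵖ`). As `k` is a field,
`Tor_i^R(M, k)` is the homology of the bar complex `M ⊗ R ⊗ ⋯ ⊗ R`, which arises from the standard
free resolution of `M` by applying `- ⊗_R k`. -/

namespace Bar

variable {k : Type u} [Field k] {R M : Type w} [Ring R] [Algebra k R] [AddCommGroup M]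
  [Module k M] [Module Rᵐᵒᵖ M] [IsScalarTower k Rᵐᵒᵖ M]

variable (k R M) in
/-- `M ⊗ R ⊗ ⋯ ⊗ R` with `n` factors `R`. -/
def Obj : ℕ → ModuleCat.{w} k
  | 0 => ModuleCat.of k M
  | n + 1 => ModuleCat.of k (Obj n ⊗[k] R)

variable (k R M) in
/-- The right action of `R` on `M` as a linear map, `m ⊗ r ↦ m r`. -/
def act : M ⊗[k] R →ₗ[k] M :=
  TensorProduct.lift (LinearMap.mk₂ k (fun m r => op r • m)
    (fun m m' r => smul_add _ m m')
    (fun c m r => smul_comm _ c m)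
    (fun m r r' => by rw [op_add, add_smul])
    (fun c m r => by rw [op_smul, smul_assoc]))

variable (k R M) in
/-- Right multiplication on the last factor:
`m ⊗ r ↦ m r` for `n = 0` and `(x ⊗ s) ⊗ r ↦ x ⊗ s r` for `n ≥ 1`. -/
def rightMul : (n : ℕ) → (Obj k R M n ⊗[k] R →ₗ[k] Obj k R M n)
  | 0 => act k R M
  | n + 1 => LinearMap.lTensor (Obj k R M n) (LinearMap.mul' k R)
      ∘ₗ (TensorProduct.assoc k (Obj k R M n) R R).toLinearMap

variable (k R M) in
/-- The differential of the standard free resolution of `M`, including the augmentation to `M`: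
`m ⊗ r₁ ⊗ ⋯ ⊗ rₙ₊₁ ↦ m r₁ ⊗ ⋯ ⊗ rₙ₊₁ + ∑ i, (-1)^i m ⊗ ⋯ ⊗ rᵢ rᵢ₊₁ ⊗ ⋯ ⊗ rₙ₊₁`. -/
def resD : (n : ℕ) → (Obj k R M (n + 1) →ₗ[k] Obj k R M n)
  | 0 => rightMul k R M 0
  | n + 1 =>
    let a : Obj k R M (n + 2) →ₗ[k] Obj k R M (n + 1) := LinearMap.rTensor R (resD n)
    let b : Obj k R M (n + 2) →ₗ[k] Obj k R M (n + 1) := rightMul k R M (n + 1)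
    a + (-1 : k) ^ (n + 1) • b

variable (M) in
/-- The augmentation on the last factor, `x ⊗ r ↦ ε(r) x`. -/
def augLast (ε : R →ₐ[k] k) (n : ℕ) : Obj k R M (n + 1) →ₗ[k] Obj k R M n :=
  (TensorProduct.rid k (Obj k R M n)).toLinearMap
    ∘ₗ LinearMap.lTensor (Obj k R M n) ε.toLinearMap

variable (M) in
/-- The differential of the bar complex:
`m ⊗ r₁ ⊗ ⋯ ⊗ rₙ₊₁ ↦ m r₁ ⊗ ⋯ ⊗ rₙ₊₁ + ∑ i, (-1)^i m ⊗ ⋯ ⊗ rᵢ rᵢ₊₁ ⊗ ⋯ ⊗ rₙ₊₁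
  + (-1)^(n + 1) ε(rₙ₊₁) m ⊗ r₁ ⊗ ⋯ ⊗ rₙ`. -/
def d (ε : R →ₐ[k] k) (n : ℕ) : Obj k R M (n + 1) →ₗ[k] Obj k R M n :=
  resD k R M n + (-1 : k) ^ (n + 1) • augLast M ε n

variable (k R M) in
/-- The pure tensor `x ⊗ r`. -/
def tmul (n : ℕ) : Obj k R M n →ₗ[k] R →ₗ[k] Obj k R M (n + 1) :=
  TensorProduct.mk k (Obj k R M n) R

theorem rightMul_zero_tmul (m : M) (r : R) :
    rightMul k R M 0 ((m : Obj k R M 0) ⊗ₜ[k] r) = (op r • m : M) := rfl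

theorem rightMul_succ_tmul (n : ℕ) (x : Obj k R M n) (s r : R) :
    rightMul k R M (n + 1) (tmul k R M n x s ⊗ₜ[k] r) = tmul k R M n x (s * r) := rfl

theorem resD_zero_tmul (x : Obj k R M 0) (r : R) :
    resD k R M 0 (tmul k R M 0 x r) = rightMul k R M 0 (x ⊗ₜ[k] r) := rfl

theorem resD_succ_tmul (n : ℕ) (x : Obj k R M (n + 1)) (r : R) :
    resD k R M (n + 1) (tmul k R M (n + 1) x r)
      = tmul k R M n (resD k R M n x) r
        + (-1 : k) ^ (n + 1) • rightMul k R M (n + 1) (x ⊗ₜ[k] r) := rfl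

theorem augLast_tmul (ε : R →ₐ[k] k) (n : ℕ) (x : Obj k R M n) (r : R) :
    augLast M ε n (tmul k R M n x r) = ε r • x := rfl

theorem induction_tmul {n : ℕ} {p : Obj k R M (n + 1) → Prop} (x : Obj k R M (n + 1))
    (h0 : p 0) (ht : ∀ x r, p (tmul k R M n x r)) (ha : ∀ x y, p x → p y → p (x + y)) : p x :=
  TensorProduct.induction_on (motive := p) x h0 ht ha

theorem rightMul_assoc (n : ℕ) (x : Obj k R M n) (s r : R) :
    rightMul k R M n (rightMul k R M n (x ⊗ₜ[k] s) ⊗ₜ[k] r)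
      = rightMul k R M n (x ⊗ₜ[k] (s * r)) := by
  cases n with
  | zero =>
    have h : ∀ m : M, (op r • op s • m : M) = op (s * r) • m := fun m => by rw [op_mul, mul_smul]
    exact h x
  | succ n =>
    induction x using induction_tmul with
    | h0 => simp
    | ht x t => simp only [rightMul_succ_tmul, mul_assoc]
    | ha x y hx hy => simp only [TensorProduct.add_tmul, map_add, hx, hy]

theorem resD_rightMul (n : ℕ) (x : Obj k R M (n + 1)) (r : R) :
    resD k R M n (rightMul k R M (n + 1) (x ⊗ₜ[k] r))
      = rightMul k R M n (resD k R M n x ⊗ₜ[k] r) := by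
  induction x using induction_tmul with
  | h0 => simp
  | ht x s =>
    rw [rightMul_succ_tmul]
    cases n with
    | zero => rw [resD_zero_tmul, resD_zero_tmul, rightMul_assoc]
    | succ n =>
      rw [resD_succ_tmul, resD_succ_tmul, TensorProduct.add_tmul, map_add, rightMul_succ_tmul,
        ← TensorProduct.smul_tmul', map_smul, rightMul_assoc]
  | ha x y hx hy => simp only [TensorProduct.add_tmul, map_add, hx, hy]

theorem resD_resD (n : ℕ) (x : Obj k R M (n + 2)) :
    resD k R M n (resD k R M (n + 1) x) = 0 := by
  induction n with
  | zero =>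
    induction x using induction_tmul with
    | h0 => simp
    | ht x r =>
      rw [resD_succ_tmul, map_add, map_smul, resD_rightMul, resD_zero_tmul]
      simp
    | ha x y hx hy => rw [map_add, map_add, hx, hy, add_zero]
  | succ n ih =>
    induction x using induction_tmul with
    | h0 => simp
    | ht x r =>
      rw [resD_succ_tmul, map_add, map_smul, resD_rightMul, resD_succ_tmul, ih, map_zero,
        LinearMap.zero_apply, zero_add, ← add_smul, pow_succ _ (n + 1)]
      simp
    | ha x y hx hy => rw [map_add, map_add, hx, hy, add_zero]

theorem augLast_rightMul (ε : R →ₐ[k] k) (n : ℕ) (x : Obj k R M (n + 1)) (r : R) :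
    augLast M ε n (rightMul k R M (n + 1) (x ⊗ₜ[k] r)) = ε r • augLast M ε n x := by
  induction x using induction_tmul with
  | h0 => simp
  | ht x s => rw [rightMul_succ_tmul, augLast_tmul, augLast_tmul, map_mul, mul_comm, mul_smul]
  | ha x y hx hy => simp only [TensorProduct.add_tmul, map_add, hx, hy, smul_add]

theorem d_d (ε : R →ₐ[k] k) (n : ℕ) : d M ε n ∘ₗ d M ε (n + 1) = 0 := by
  ext1 x
  induction x using induction_tmul with
  | h0 => simp
  | ht x r =>
    have h := resD_resD n (tmul k R M (n + 1) x r)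
    simp only [d, LinearMap.comp_apply, LinearMap.add_apply, LinearMap.smul_apply, map_add,
      map_smul, h, augLast_tmul, LinearMap.zero_apply]
    simp only [resD_succ_tmul, map_add, map_smul, augLast_tmul, augLast_rightMul]
    module
  | ha x y hx hy => rw [map_add, hx, hy]; simp

variable (M) in
/-- The bar complex `⋯ ⟶ M ⊗ R ⊗ R ⟶ M ⊗ R ⟶ M`. -/
def complex (ε : R →ₐ[k] k) : ChainComplex (ModuleCat.{w} k) ℕ :=
  ChainComplex.of (Obj k R M) (fun n => ModuleCat.ofHom (d M ε n)) (fun n =>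
    ModuleCat.hom_ext (d_d ε n))

/-- The homogeneous part of degree `j` of `M ⊗ R ⊗ ⋯ ⊗ R`, for gradings `𝒜` of `R` and `ℳ` of `M`:
the span of the `m ⊗ r₁ ⊗ ⋯ ⊗ rₙ` with homogeneous entries whose degrees add up to `j`. -/
def objDeg (𝒜 : ℕ → Submodule k R) (ℳ : ℕ → Submodule k M) :
    (n : ℕ) → ℕ → Submodule k (Obj k R M n)
  | 0 => ℳ
  | n + 1 => fun j => ⨆ p ∈ Finset.HasAntidiagonal.antidiagonal j,
      Submodule.map₂ (tmul k R M n) (objDeg 𝒜 ℳ n p.1) (𝒜 p.2)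

end Bar

section Homology

variable {k : Type u} [Field k] {R M : Type w} [Ring R] [Algebra k R] [AddCommGroup M]
  [Module k M] [Module Rᵐᵒᵖ M] [IsScalarTower k Rᵐᵒᵖ M]

variable (M) in
/-- `H_i(R, M) = Tor_i^R(M, k)`, where `k` is a left `R`-module through the augmentation `ε`. -/
abbrev algHomology (ε : R →ₐ[k] k) (i : ℕ) : ModuleCat.{w} k :=
  (Bar.complex M ε).homology i

/-- `H_i(R, M)_j`: the classes of the homogeneous cycles of degree `j`. -/
def algHomologyDeg (ε : R →ₐ[k] k) (𝒜 : ℕ → Submodule k R) (ℳ : ℕ → Submodule k M) (i j : ℕ) :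
    Submodule k (algHomology M ε i) :=
  ((Bar.objDeg 𝒜 ℳ i j).comap ((Bar.complex M ε).iCycles i).hom).map
    ((Bar.complex M ε).homologyπ i).hom

/-- `R`, with the grading `𝒜` and the augmentation `ε`, is a standard algebra: positively graded
with finite-dimensional components, connected, and generated in degree one;
`ε` is the projection to `R₀ = k`. -/
structure IsStandardGraded (ε : R →ₐ[k] k) (𝒜 : ℕ → Submodule k R) : Prop where
  internal : DirectSum.IsInternal 𝒜
  graded : SetLike.GradedMonoid 𝒜
  finite : ∀ n, Module.Finite k (𝒜 n)
  connected : 𝒜 0 = 1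
  generated : Algebra.adjoin k (𝒜 1 : Set R) = ⊤
  aug_eq_zero : ∀ n, 0 < n → ∀ r ∈ 𝒜 n, ε r = 0

/-- `M` is a positively graded right module over the graded algebra `R`. -/
structure IsGradedRightModule (𝒜 : ℕ → Submodule k R) (ℳ : ℕ → Submodule k M) : Prop where
  internal : DirectSum.IsInternal ℳ
  smul_mem : ∀ i j, ∀ m ∈ ℳ i, ∀ r ∈ 𝒜 j, op r • m ∈ ℳ (i + j)
  finite : ∀ n, Module.Finite k (ℳ n)

/-- The graded right module `M` over the standard algebra `R` is Koszul, generated in degree `d`: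
the graded vector space `H_i(R, M)` is concentrated in degree `i + d` for all `i`. -/
structure IsKoszulModule (ε : R →ₐ[k] k) (𝒜 : ℕ → Submodule k R) (ℳ : ℕ → Submodule k M)
    (d : ℕ) : Prop where
  standard : IsStandardGraded ε 𝒜
  graded : IsGradedRightModule 𝒜 ℳ
  internal : ∀ i, DirectSum.IsInternal (algHomologyDeg ε 𝒜 ℳ i)
  concentrated : ∀ i j, j ≠ i + d → algHomologyDeg ε 𝒜 ℳ i j = ⊥

end Homology

namespace ColorLieAlgebra

variable {Γ : Type w} {k : Type u} [AddCommGroup Γ] [DecidableEq Γ] [Field k]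
  {ε : CommutationFactor Γ k} {g : Type v} [AddCommGroup g] [Module k g]
  (L : ColorLieAlgebra ε g)

/-- `H_i(g, M) = H_i(U(g), M)` for `M = U(g) / W U(g)`. -/
abbrev homology (W : Set g) (i : ℕ) : ModuleCat.{max u v} k :=
  algHomology (L.CyclicModule W) L.aug i

/-- The degree `j` part of `H_i(g, U(g) / W U(g))`. -/
abbrev homologyDeg (W : Set g) (i j : ℕ) : Submodule k (L.homology W i) :=
  algHomologyDeg L.aug L.ueaDeg (L.cyclicDeg W) i j

end ColorLieAlgebra

end

/-!
For a homogeneous basis `x i` of an abelian color Lie algebra `g`, the algebra `U(g)` is a skew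
polynomial algebra: `x i * x j = q i j • (x j * x i)`, and `(x i)² = 0` exactly when `q i i ≠ 1`.
Its ordered monomials are linearly independent, because the variables act on the space of formal
monomials by operators that satisfy the same relations.

Membership in the right ideal generated by a set `S` of variables can be read off the monomials, so
for `i ∉ S` the colon ideal `(S U(g) : x i)` is again generated by variables: by `S`, together with
`x i` when `(x i)² = 0`. The exact sequence `0 ⟶ (A / (J : x))(-1) ⟶ A / J ⟶ A / (x A + J) ⟶ 0`
and the long exact sequence of `Tor` then give the concentration of `Tor i` in degree `i` for all
these ideals at once, by induction on `i` and on the number of generators.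
-/

noncomputable section

open DirectSum

section GradedModules

variable {ι k V W : Type*} [DecidableEq ι] [CommRing k] [AddCommGroup V] [Module k V]
  [AddCommGroup W] [Module k W]

/-- The linear map `f` sends elements of degree `j` to elements of degree `j + s`. -/
def HasDegree [Add ι] (f : V →ₗ[k] W) (s : ι) (𝒱 : ι → Submodule k V)
    (𝒲 : ι → Submodule k W) : Prop :=
  ∀ ⦃j x⦄, x ∈ 𝒱 j → f x ∈ 𝒲 (j + s)

namespace HasDegree

variable [Add ι] {𝒱 : ι → Submodule k V} {𝒲 : ι → Submodule k W} [Decomposition 𝒱]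
  [Decomposition 𝒲] {f : V →ₗ[k] W} {s : ι}

theorem map_decompose [IsRightCancelAdd ι] (hf : HasDegree f s 𝒱 𝒲) (x : V) (j : ι) :
    f (decompose 𝒱 x j) = decompose 𝒲 (f x) (j + s) := by
  induction x using Decomposition.inductionOn 𝒱 with
  | zero => simp
  | @homogeneous i x =>
    by_cases hij : i = j
    · subst hij
      rw [decompose_coe, of_eq_same, decompose_of_mem_same _ (hf x.2)]
    · rw [decompose_of_mem_ne _ x.2 hij,
        decompose_of_mem_ne _ (hf x.2) (mt add_right_cancel hij), map_zero]
  | add x y hx hy =>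
    simp only [decompose_add, map_add, DirectSum.add_apply, Submodule.coe_add, hx, hy]

theorem decompose_map_eq_zero (hf : HasDegree f s 𝒱 𝒲) {j : ι} (hj : ∀ i, i + s ≠ j) (x : V) :
    (decompose 𝒲 (f x) j : W) = 0 := by
  induction x using Decomposition.inductionOn 𝒱 with
  | zero => simp
  | homogeneous x => exact decompose_of_mem_ne _ (hf x.2) (hj _)
  | add x y hx hy =>
    simp only [decompose_add, map_add, DirectSum.add_apply, Submodule.coe_add, hx, hy, add_zero]

theorem exists_mem_apply_eq [IsRightCancelAdd ι] (hf : HasDegree f s 𝒱 𝒲) {j : ι} {x : V}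
    (hx : f x ∈ 𝒲 (j + s)) : ∃ y ∈ 𝒱 j, f y = f x :=
  ⟨decompose 𝒱 x j, SetLike.coe_mem _, by rw [hf.map_decompose, decompose_of_mem_same _ hx]⟩

theorem apply_eq_zero (hf : HasDegree f s 𝒱 𝒲) {j : ι} (hj : ∀ i, i + s ≠ j) {x : V}
    (hx : f x ∈ 𝒲 j) : f x = 0 := by
  rw [← decompose_of_mem_same 𝒲 hx, hf.decompose_map_eq_zero hj]

end HasDegree

theorem isInternal_of_projections {𝒱 : ι → Submodule k V} {π : ι → V →ₗ[k] V}
    (hself : ∀ j, ∀ x ∈ 𝒱 j, π j x = x) (hne : ∀ i j, i ≠ j → ∀ x ∈ 𝒱 i, π j x = 0)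
    (htop : ⨆ j, 𝒱 j = ⊤) : IsInternal 𝒱 := by
  refine isInternal_submodule_of_iSupIndep_of_iSup_eq_top (fun i => ?_) htop
  refine Submodule.disjoint_def.2 fun x hx hx' => ?_
  have hle : ⨆ j, ⨆ (_ : j ≠ i), 𝒱 j ≤ LinearMap.ker (π i) :=
    iSup₂_le fun j hj => hne j i hj
  rw [← hself i x hx]
  exact hle hx'

section Projection

variable (𝒱 : ι → Submodule k V) [Decomposition 𝒱]

/-- The projection of a graded module onto its component of degree `j`, as an endomorphism. -/
def componentProj (j : ι) : V →ₗ[k] V :=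
  (𝒱 j).subtype ∘ₗ component k ι (fun j => 𝒱 j) j ∘ₗ (decomposeLinearEquiv 𝒱).toLinearMap

variable {𝒱} in
theorem componentProj_of_mem_same {j : ι} {x : V} (hx : x ∈ 𝒱 j) : componentProj 𝒱 j x = x :=
  decompose_of_mem_same 𝒱 hx

variable {𝒱} in
theorem componentProj_of_mem_ne {i j : ι} {x : V} (hx : x ∈ 𝒱 i) (hij : i ≠ j) :
    componentProj 𝒱 j x = 0 :=
  decompose_of_mem_ne 𝒱 hx hij

end Projection

theorem isInternal_map {𝒱 : ι → Submodule k V} [Decomposition 𝒱] {f : V →ₗ[k] W}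
    (hf : Function.Surjective f)
    (hker : ∀ x, f x = 0 → ∀ j, f (decompose 𝒱 x j) = 0) :
    IsInternal fun j => (𝒱 j).map f := by
  refine isInternal_submodule_of_iSupIndep_of_iSup_eq_top (fun i => ?_) ?_
  · simp only [← Submodule.map_iSup]
    refine Submodule.disjoint_def.2 ?_
    rintro _ ⟨x, hx, rfl⟩ ⟨y, hy, hyx⟩
    have hle : ⨆ j, ⨆ (_ : j ≠ i), 𝒱 j ≤ LinearMap.ker (componentProj 𝒱 i) :=
      iSup₂_le fun j hj z hz => componentProj_of_mem_ne hz hj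
    have hxy : componentProj 𝒱 i (x - y) = x := by
      rw [map_sub, componentProj_of_mem_same hx, LinearMap.mem_ker.1 (hle hy), sub_zero]
    rw [← hxy]
    exact hker (x - y) (by rw [map_sub, hyx, sub_self]) i
  · rw [← Submodule.map_iSup, (Decomposition.isInternal 𝒱).submodule_iSup_eq_top,
      Submodule.map_top, LinearMap.range_eq_top.2 hf]

theorem isInternal_comap {𝒲 : ι → Submodule k W} [Decomposition 𝒲] {f : V →ₗ[k] W}
    (hf : Function.Injective f) (hrange : ∀ x j, (decompose 𝒲 (f x) j : W) ∈ LinearMap.range f) :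
    IsInternal fun j => (𝒲 j).comap f := by
  classical
  have h𝒲 := Decomposition.isInternal 𝒲
  refine isInternal_submodule_of_iSupIndep_of_iSup_eq_top (fun i => ?_) (eq_top_iff.2 fun x _ => ?_)
  · refine Submodule.disjoint_def.2 fun x hx hx' => ?_
    have hle : ⨆ j, ⨆ (_ : j ≠ i), (𝒲 j).comap f ≤ (⨆ j, ⨆ (_ : j ≠ i), 𝒲 j).comap f :=
      iSup₂_le fun j hj => Submodule.comap_mono (le_iSup₂_of_le j hj le_rfl)
    exact (map_eq_zero_iff f hf).1
      (Submodule.disjoint_def.1 (h𝒲.submodule_iSupIndep i) _ hx (hle hx'))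
  · choose c hc using hrange x
    have hx : x = ∑ j ∈ (decompose 𝒲 (f x)).support, c j :=
      hf (by simp only [map_sum, hc, sum_support_decompose])
    rw [hx]
    exact sum_mem fun j _ => Submodule.mem_iSup_of_mem j (hc j ▸ SetLike.coe_mem _ : f (c j) ∈ 𝒲 j)

open Finset.HasAntidiagonal in
theorem isInternal_tensorProduct [AddCommMonoid ι] [Finset.HasAntidiagonal ι]
    (𝒱 : ι → Submodule k V) [Decomposition 𝒱] (𝒲 : ι → Submodule k W) [Decomposition 𝒲] :
    IsInternal fun j => ⨆ p ∈ antidiagonal j,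
      Submodule.map₂ (TensorProduct.mk k V W) (𝒱 p.1) (𝒲 p.2) := by
  let π (j : ι) : V ⊗[k] W →ₗ[k] V ⊗[k] W :=
    ∑ p ∈ antidiagonal j, TensorProduct.map (componentProj 𝒱 p.1) (componentProj 𝒲 p.2)
  have hπ : ∀ j (p : ι × ι), ∀ x ∈ 𝒱 p.1, ∀ y ∈ 𝒲 p.2,
      π j (x ⊗ₜ[k] y) = if p ∈ antidiagonal j then x ⊗ₜ[k] y else 0 := by
    intro j p x hx y hy
    have hterm : ∀ q : ι × ι, componentProj 𝒱 q.1 x ⊗ₜ[k] componentProj 𝒲 q.2 y =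
        if q = p then x ⊗ₜ[k] y else 0 := by
      intro q
      split_ifs with hqp
      · rw [hqp, componentProj_of_mem_same hx, componentProj_of_mem_same hy]
      · by_cases h₁ : p.1 = q.1
        · have h₂ : p.2 ≠ q.2 := fun h₂ => hqp (Prod.ext h₁.symm h₂.symm)
          rw [componentProj_of_mem_ne hy h₂, TensorProduct.tmul_zero]
        · rw [componentProj_of_mem_ne hx h₁, TensorProduct.zero_tmul]
    simp only [π, LinearMap.sum_apply, TensorProduct.map_tmul, hterm, Finset.sum_ite_eq']
  refine isInternal_of_projections (π := π) (fun j t ht => ?_) (fun i j hij t ht => ?_) ?_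
  · have hle : (⨆ p ∈ antidiagonal j, Submodule.map₂ (TensorProduct.mk k V W) (𝒱 p.1) (𝒲 p.2)) ≤
        LinearMap.eqLocus (π j) LinearMap.id :=
      iSup₂_le fun p hp => Submodule.map₂_le.2 fun x hx y hy =>
        (hπ j p x hx y hy).trans (if_pos hp)
    exact hle ht
  · have hle : (⨆ p ∈ antidiagonal i, Submodule.map₂ (TensorProduct.mk k V W) (𝒱 p.1) (𝒲 p.2)) ≤
        LinearMap.ker (π j) :=
      iSup₂_le fun p hp => Submodule.map₂_le.2 fun x hx y hy =>
        (hπ j p x hx y hy).trans (if_neg fun hp' =>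
          hij ((mem_antidiagonal.1 hp).symm.trans (mem_antidiagonal.1 hp')))
    exact hle ht
  · rw [eq_top_iff, ← TensorProduct.map₂_mk_top_top_eq_top,
      ← (Decomposition.isInternal 𝒱).submodule_iSup_eq_top,
      ← (Decomposition.isInternal 𝒲).submodule_iSup_eq_top, Submodule.map₂_iSup_left]
    simp_rw [Submodule.map₂_iSup_right]
    exact iSup₂_le fun p q => le_iSup_of_le (p + q)
      (le_iSup₂_of_le (p, q) (mem_antidiagonal.2 rfl) le_rfl)

end GradedModules

namespace Bar

variable {k : Type u} [Field k] {R M N P : Type w} [Ring R] [Algebra k R]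
  [AddCommGroup M] [Module k M] [AddCommGroup N] [Module k N] [AddCommGroup P] [Module k P]

theorem hom_ext {V : Type*} [AddCommGroup V] [Module k V] {n : ℕ}
    {f g : Obj k R M (n + 1) →ₗ[k] V}
    (h : ∀ x r, f (tmul k R M n x r) = g (tmul k R M n x r)) : f = g :=
  TensorProduct.ext' h

section Degree

variable {𝒜 : ℕ → Submodule k R} {ℳ : ℕ → Submodule k M}

theorem tmul_mem_objDeg {n a b : ℕ} {x : Obj k R M n} (hx : x ∈ objDeg 𝒜 ℳ n a) {r : R}
    (hr : r ∈ 𝒜 b) : tmul k R M n x r ∈ objDeg 𝒜 ℳ (n + 1) (a + b) :=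
  Submodule.mem_iSup_of_mem (a, b) (Submodule.mem_iSup_of_mem
    (Finset.HasAntidiagonal.mem_antidiagonal.2 rfl) (Submodule.apply_mem_map₂ _ hx hr))

theorem objDeg_succ_le {n j : ℕ} {S : Submodule k (Obj k R M (n + 1))}
    (h : ∀ a b, a + b = j → ∀ x ∈ objDeg 𝒜 ℳ n a, ∀ r ∈ 𝒜 b, tmul k R M n x r ∈ S) :
    objDeg 𝒜 ℳ (n + 1) j ≤ S :=
  iSup₂_le fun p hp => Submodule.map₂_le.2
    (h p.1 p.2 (Finset.HasAntidiagonal.mem_antidiagonal.1 hp))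

variable (𝒜 ℳ) in
theorem isInternal_objDeg [Decomposition 𝒜] [Decomposition ℳ] (n : ℕ) :
    IsInternal (objDeg 𝒜 ℳ n) := by
  induction n with
  | zero => exact Decomposition.isInternal ℳ
  | succ n ih =>
    have := ih.chooseDecomposition
    exact isInternal_tensorProduct (objDeg 𝒜 ℳ n) 𝒜

instance [Decomposition 𝒜] [Decomposition ℳ] (n : ℕ) : Decomposition (objDeg 𝒜 ℳ n) :=
  (isInternal_objDeg 𝒜 ℳ n).chooseDecomposition

end Degree

variable [Module Rᵐᵒᵖ M] [IsScalarTower k Rᵐᵒᵖ M] [Module Rᵐᵒᵖ N] [IsScalarTower k Rᵐᵒᵖ N]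
  [Module Rᵐᵒᵖ P] [IsScalarTower k Rᵐᵒᵖ P]

/-- The map `f ⊗ id ⊗ ⋯ ⊗ id` of bar complexes induced by a map `f` of right modules. -/
def map (f : M →ₗ[Rᵐᵒᵖ] N) : (n : ℕ) → (Obj k R M n →ₗ[k] Obj k R N n)
  | 0 => f.restrictScalars k
  | n + 1 => LinearMap.rTensor R (map f n)

section Map

variable (f : M →ₗ[Rᵐᵒᵖ] N)

theorem map_tmul (n : ℕ) (x : Obj k R M n) (r : R) :
    map f (n + 1) (tmul k R M n x r) = tmul k R N n (map f n x) r := rfl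

theorem map_rightMul (n : ℕ) (x : Obj k R M n) (r : R) :
    map f n (rightMul k R M n (x ⊗ₜ[k] r)) = rightMul k R N n (map f n x ⊗ₜ[k] r) := by
  suffices h : map f n ∘ₗ rightMul k R M n = rightMul k R N n ∘ₗ LinearMap.rTensor R (map f n) from
    LinearMap.congr_fun h (x ⊗ₜ[k] r)
  cases n with
  | zero => exact TensorProduct.ext' fun m r => f.map_smul (op r) m
  | succ n => exact TensorProduct.ext_threefold fun x s r => rfl

theorem map_comp_resD (n : ℕ) :
    map f n ∘ₗ resD k R M n = resD k R N n ∘ₗ map f (n + 1) := by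
  induction n with
  | zero => exact hom_ext fun m r => map_rightMul f 0 m r
  | succ n ih =>
    refine hom_ext fun x r => ?_
    have ih_x := LinearMap.congr_fun ih x
    simp only [LinearMap.comp_apply] at ih_x ⊢
    rw [resD_succ_tmul, map_add, map_smul, map_rightMul, map_tmul, map_tmul, resD_succ_tmul, ih_x]

theorem map_comp_augLast (ε : R →ₐ[k] k) (n : ℕ) :
    map f n ∘ₗ augLast M ε n = augLast N ε n ∘ₗ map f (n + 1) :=
  hom_ext fun x r => by
    simp only [LinearMap.comp_apply, augLast_tmul, map_smul, map_tmul]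

theorem map_d (ε : R →ₐ[k] k) (n : ℕ) (x : Obj k R M (n + 1)) :
    map f n (d M ε n x) = d N ε n (map f (n + 1) x) := by
  have hres := LinearMap.congr_fun (map_comp_resD (k := k) f n) x
  have haug := LinearMap.congr_fun (map_comp_augLast f ε n) x
  simp only [LinearMap.comp_apply] at hres haug
  simp only [d, LinearMap.add_apply, LinearMap.smul_apply, map_add, map_smul, hres, haug]

variable {f}

theorem map_injective (hf : Function.Injective f) (n : ℕ) :
    Function.Injective (map (k := k) f n) := by
  induction n with
  | zero => exact hf
  | succ n ih => exact Module.Flat.rTensor_preserves_injective_linearMap _ ih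

theorem map_surjective (hf : Function.Surjective f) (n : ℕ) :
    Function.Surjective (map (k := k) f n) := by
  induction n with
  | zero => exact hf
  | succ n ih => exact LinearMap.rTensor_surjective _ ih

theorem map_exact {p : N →ₗ[Rᵐᵒᵖ] P} (hp : Function.Surjective p) (h : Function.Exact f p)
    (n : ℕ) : Function.Exact (map (k := k) f n) (map (k := k) p n) := by
  induction n with
  | zero => exact h
  | succ n ih => exact rTensor_exact R ih (map_surjective hp n)

end Map

/-- The right action of `R` on `M` is compatible with the gradings. -/
def IsGradedRightSMul (𝒜 : ℕ → Submodule k R) (ℳ : ℕ → Submodule k M) : Prop :=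
  ∀ i j, ∀ m ∈ ℳ i, ∀ r ∈ 𝒜 j, op r • m ∈ ℳ (i + j)

section MapDegree

variable {𝒜 : ℕ → Submodule k R} {ℳ : ℕ → Submodule k M} {𝒩 : ℕ → Submodule k N}
  {f : M →ₗ[Rᵐᵒᵖ] N}

theorem hasDegree_map {s : ℕ} (hf : HasDegree (f.restrictScalars k) s ℳ 𝒩) (n : ℕ) :
    HasDegree (map f n) s (objDeg 𝒜 ℳ n) (objDeg 𝒜 𝒩 n) := by
  induction n with
  | zero => exact hf
  | succ n ih =>
    intro j t ht
    refine objDeg_succ_le (S := (objDeg 𝒜 𝒩 (n + 1) (j + s)).comap (map f (n + 1))) ?_ ht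
    rintro a b rfl x hx r hr
    rw [Submodule.mem_comap, map_tmul, add_right_comm]
    exact tmul_mem_objDeg (ih hx) hr

theorem objDeg_le_map (hf : ∀ j, 𝒩 j ≤ (ℳ j).map (f.restrictScalars k)) (n j : ℕ) :
    objDeg 𝒜 𝒩 n j ≤ (objDeg 𝒜 ℳ n j).map (map f n) := by
  induction n generalizing j with
  | zero => exact hf j
  | succ n ih =>
    refine objDeg_succ_le ?_
    rintro a b rfl y hy r hr
    obtain ⟨x, hx, rfl⟩ := ih a hy
    exact ⟨_, tmul_mem_objDeg hx hr, map_tmul f n x r⟩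

theorem hasDegree_augLast {ε : R →ₐ[k] k} (hε : ∀ n, 0 < n → ∀ r ∈ 𝒜 n, ε r = 0) (n : ℕ) :
    HasDegree (augLast M ε n) 0 (objDeg 𝒜 ℳ (n + 1)) (objDeg 𝒜 ℳ n) := by
  intro j t ht
  refine objDeg_succ_le (S := (objDeg 𝒜 ℳ n j).comap (augLast M ε n)) ?_ ht
  rintro a b rfl x hx r hr
  rw [Submodule.mem_comap, augLast_tmul]
  rcases Nat.eq_zero_or_pos b with rfl | hb
  · exact Submodule.smul_mem _ _ hx
  · rw [hε b hb r hr, zero_smul]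
    exact zero_mem _

variable [SetLike.GradedMul 𝒜]

theorem rightMul_mem_objDeg (hℳ : IsGradedRightSMul 𝒜 ℳ) {n a b : ℕ} {t : Obj k R M n}
    (ht : t ∈ objDeg 𝒜 ℳ n a) {r : R} (hr : r ∈ 𝒜 b) :
    rightMul k R M n (t ⊗ₜ[k] r) ∈ objDeg 𝒜 ℳ n (a + b) := by
  cases n with
  | zero => exact hℳ a b t ht r hr
  | succ n =>
    refine objDeg_succ_le (S := (objDeg 𝒜 ℳ (n + 1) (a + b)).comap
      (rightMul k R M (n + 1) ∘ₗ (TensorProduct.mk k _ R).flip r)) ?_ ht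
    rintro a c rfl x hx s hs
    rw [add_assoc]
    exact tmul_mem_objDeg hx (SetLike.mul_mem_graded hs hr)

theorem hasDegree_resD (hℳ : IsGradedRightSMul 𝒜 ℳ) (n : ℕ) :
    HasDegree (resD k R M n) 0 (objDeg 𝒜 ℳ (n + 1)) (objDeg 𝒜 ℳ n) := by
  induction n with
  | zero =>
    intro j t ht
    refine objDeg_succ_le (S := (objDeg 𝒜 ℳ 0 j).comap (resD k R M 0)) ?_ ht
    rintro a b rfl x hx r hr
    exact rightMul_mem_objDeg hℳ hx hr
  | succ n ih =>
    intro j t ht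
    refine objDeg_succ_le (S := (objDeg 𝒜 ℳ (n + 1) j).comap (resD k R M (n + 1))) ?_ ht
    rintro a b rfl x hx r hr
    rw [Submodule.mem_comap, resD_succ_tmul]
    exact add_mem (tmul_mem_objDeg (ih hx) hr)
      (Submodule.smul_mem _ _ (rightMul_mem_objDeg hℳ hx hr))

theorem hasDegree_d {ε : R →ₐ[k] k} (hε : ∀ n, 0 < n → ∀ r ∈ 𝒜 n, ε r = 0)
    (hℳ : IsGradedRightSMul 𝒜 ℳ) (n : ℕ) :
    HasDegree (d M ε n) 0 (objDeg 𝒜 ℳ (n + 1)) (objDeg 𝒜 ℳ n) := fun _ _ hx =>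
  add_mem (hasDegree_resD hℳ n hx) (Submodule.smul_mem _ _ (hasDegree_augLast hε n hx))

end MapDegree

variable (M) in
/-- The cycles of the bar complex, that is, the kernel of the differential; everything is a cycle
in degree `0`. -/
def cycles (ε : R →ₐ[k] k) : (n : ℕ) → Submodule k (Obj k R M n)
  | 0 => ⊤
  | n + 1 => LinearMap.ker (d M ε n)

theorem d_mem_cycles (ε : R →ₐ[k] k) (n : ℕ) (x : Obj k R M (n + 1)) :
    d M ε n x ∈ cycles (k := k) M ε n := by
  cases n with
  | zero => exact Submodule.mem_top
  | succ n => exact LinearMap.congr_fun (d_d ε n) x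

theorem mem_cycles_of_map_mem (ε : R →ₐ[k] k) {f : M →ₗ[Rᵐᵒᵖ] N} (hf : Function.Injective f)
    {n : ℕ} {x : Obj k R M n} (hx : map f n x ∈ cycles N ε n) : x ∈ cycles M ε n := by
  cases n with
  | zero => trivial
  | succ n => exact map_injective hf n (by rw [map_d, map_zero, LinearMap.mem_ker.1 hx])

/-- Every homogeneous cycle of degree `j` in `M ⊗ R^{⊗ i}` is a boundary, i.e. `H_i(R, M)_j = 0`. -/
def VanishesAt (ε : R →ₐ[k] k) (𝒜 : ℕ → Submodule k R) (ℳ : ℕ → Submodule k M) (i j : ℕ) : Prop :=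
  objDeg 𝒜 ℳ i j ⊓ cycles M ε i ≤ LinearMap.range (d M ε i)

section LongExactSequence

variable {ε : R →ₐ[k] k} {𝒜 : ℕ → Submodule k R} [Decomposition 𝒜]
  {ℳ : ℕ → Submodule k M} [Decomposition ℳ] {𝒩 : ℕ → Submodule k N} [Decomposition 𝒩]
  {𝒬 : ℕ → Submodule k P} {f : M →ₗ[Rᵐᵒᵖ] N} {p : N →ₗ[Rᵐᵒᵖ] P} {i j s : ℕ}

theorem exists_lift_boundary [SetLike.GradedMul 𝒜]
    (hε : ∀ n, 0 < n → ∀ r ∈ 𝒜 n, ε r = 0) (hℳ : IsGradedRightSMul 𝒜 ℳ)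
    (hf : Function.Injective f) (hfdeg : HasDegree (f.restrictScalars k) s ℳ 𝒩)
    (h : ∀ l, l + s = j → VanishesAt ε 𝒜 ℳ i l) {z : Obj k R M i}
    (hz : map f i z ∈ objDeg 𝒜 𝒩 i j) (hzc : map f i z ∈ cycles N ε i) :
    ∃ t, map f (i + 1) t ∈ objDeg 𝒜 𝒩 (i + 1) j ∧ d N ε i (map f (i + 1) t) = map f i z := by
  by_cases hj : ∃ l, l + s = j
  · obtain ⟨l, rfl⟩ := hj
    obtain ⟨z', hz', hzz'⟩ := (hasDegree_map hfdeg i).exists_mem_apply_eq hz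
    rw [← hzz'] at hzc ⊢
    obtain ⟨t, ht⟩ := h l rfl ⟨hz', mem_cycles_of_map_mem ε hf hzc⟩
    obtain ⟨t', ht', htt'⟩ :=
      (hasDegree_d hε hℳ i).exists_mem_apply_eq (j := l) (x := t) (ht ▸ hz')
    exact ⟨t', hasDegree_map hfdeg (i + 1) ht', by rw [← map_d, htt', ht]⟩
  · push Not at hj
    exact ⟨0, by rw [map_zero]; exact zero_mem _,
      by rw [map_zero, map_zero, (hasDegree_map hfdeg i).apply_eq_zero hj hz]⟩

/-- The part `H_{i+1}(N)_j ⟶ H_{i+1}(P)_j ⟶ H_i(M)_{j-s}` of the long exact homology sequence of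
`0 ⟶ M(-s) ⟶ N ⟶ P ⟶ 0`. -/
theorem VanishesAt.of_shortExact [SetLike.GradedMul 𝒜]
    (hε : ∀ n, 0 < n → ∀ r ∈ 𝒜 n, ε r = 0)
    (hℳ : IsGradedRightSMul 𝒜 ℳ) (h𝒩 : IsGradedRightSMul 𝒜 𝒩)
    (hf : Function.Injective f) (hp : Function.Surjective p) (hfp : Function.Exact f p)
    (hfdeg : HasDegree (f.restrictScalars k) s ℳ 𝒩)
    (hpdeg : ∀ j, 𝒬 j ≤ (𝒩 j).map (p.restrictScalars k))
    (hN : VanishesAt ε 𝒜 𝒩 (i + 1) j) (hM : ∀ l, l + s = j → VanishesAt ε 𝒜 ℳ i l) :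
    VanishesAt ε 𝒜 𝒬 (i + 1) j := by
  rintro _ ⟨hx, hxc⟩
  obtain ⟨y, hy, rfl⟩ := objDeg_le_map hpdeg (i + 1) j hx
  have hpdy : map p i (d N ε i y) = 0 := (map_d p ε i y).trans hxc
  obtain ⟨z, hz⟩ := (map_exact hp hfp i _).1 hpdy
  obtain ⟨t, ht, hdt⟩ := exists_lift_boundary hε hℳ hf hfdeg hM (z := z)
    (hz ▸ hasDegree_d hε h𝒩 i hy) (hz ▸ d_mem_cycles ε i y)
  obtain ⟨w, hw⟩ := hN ⟨sub_mem hy ht,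
    LinearMap.mem_ker.2 (by rw [map_sub, hdt, hz, sub_self])⟩
  refine ⟨map p (i + 2) w, ?_⟩
  rw [← map_d, hw, map_sub, (map_exact hp hfp (i + 1)).apply_apply_eq_zero, sub_zero]

end LongExactSequence

section Contraction

variable (e : M ≃ₗ[Rᵐᵒᵖ] R)

/-- The contraction `m ⊗ r₁ ⊗ ⋯ ⊗ rₙ ↦ e⁻¹(1) ⊗ e(m) ⊗ r₁ ⊗ ⋯ ⊗ rₙ` of the standard free resolution
of a free module of rank one. -/
def contract : (n : ℕ) → (Obj k R M n →ₗ[k] Obj k R M (n + 1))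
  | 0 => tmul k R M 0 (e.symm 1) ∘ₗ e.toLinearMap.restrictScalars k
  | n + 1 => LinearMap.rTensor R (contract n)

theorem contract_tmul (n : ℕ) (x : Obj k R M n) (r : R) :
    contract e (n + 1) (tmul k R M n x r) = tmul k R M (n + 1) (contract e n x) r := rfl

theorem contract_rightMul (n : ℕ) (x : Obj k R M n) (r : R) :
    contract e n (rightMul k R M n (x ⊗ₜ[k] r))
      = rightMul k R M (n + 1) (contract e n x ⊗ₜ[k] r) := by
  suffices h : contract e n ∘ₗ rightMul k R M n =
      rightMul k R M (n + 1) ∘ₗ LinearMap.rTensor R (contract e n) from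
    LinearMap.congr_fun h (x ⊗ₜ[k] r)
  cases n with
  | zero =>
    exact TensorProduct.ext' fun m r => congrArg (tmul k R M 0 (e.symm 1)) (e.map_smul (op r) m)
  | succ n => exact TensorProduct.ext_threefold fun x s r => rfl

theorem resD_contract_zero (m : Obj k R M 0) : resD k R M 0 (contract e 0 m) = m := by
  have h (m : M) : op (e m) • e.symm 1 = m := by
    rw [← map_smul, op_smul_eq_mul, one_mul, e.symm_apply_apply]
  exact h m

theorem resD_contract_succ (n : ℕ) (x : Obj k R M (n + 1)) :
    resD k R M (n + 1) (contract e (n + 1) x) = x - contract e n (resD k R M n x) := by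
  revert x
  suffices h : resD k R M (n + 1) ∘ₗ contract e (n + 1) =
      LinearMap.id - contract e n ∘ₗ resD k R M n from LinearMap.congr_fun h
  induction n with
  | zero =>
    refine hom_ext fun m r => ?_
    simp only [LinearMap.comp_apply, LinearMap.sub_apply, LinearMap.id_apply]
    rw [contract_tmul, resD_succ_tmul, resD_contract_zero, resD_zero_tmul, contract_rightMul]
    module
  | succ n ih =>
    refine hom_ext fun x r => ?_
    have ih_x := LinearMap.congr_fun ih x
    simp only [LinearMap.comp_apply, LinearMap.sub_apply, LinearMap.id_apply] at ih_x ⊢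
    rw [contract_tmul, resD_succ_tmul, ih_x, resD_succ_tmul, map_add, map_smul, contract_tmul,
      contract_rightMul, map_sub, LinearMap.sub_apply, pow_succ _ (n + 1)]
    module

theorem augLast_contract (ε : R →ₐ[k] k) (n : ℕ) (x : Obj k R M (n + 1)) :
    augLast M ε (n + 1) (contract e (n + 1) x) = contract e n (augLast M ε n x) := by
  suffices h : augLast M ε (n + 1) ∘ₗ contract e (n + 1) = contract e n ∘ₗ augLast M ε n from
    LinearMap.congr_fun h x
  exact hom_ext fun x r => by
    simp only [LinearMap.comp_apply, contract_tmul, augLast_tmul, map_smul]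

theorem d_contract (ε : R →ₐ[k] k) (n : ℕ) (x : Obj k R M (n + 1)) :
    d M ε (n + 1) (contract e (n + 1) x) = x - contract e n (d M ε n x) := by
  simp only [d, LinearMap.add_apply, LinearMap.smul_apply, map_add, map_smul,
    resD_contract_succ, augLast_contract, pow_succ _ (n + 1)]
  module

end Contraction

theorem vanishesAt_succ_of_equiv (e : M ≃ₗ[Rᵐᵒᵖ] R) (ε : R →ₐ[k] k) (𝒜 : ℕ → Submodule k R)
    (ℳ : ℕ → Submodule k M) (i j : ℕ) : VanishesAt ε 𝒜 ℳ (i + 1) j := by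
  rintro x ⟨-, hx⟩
  exact ⟨contract e (i + 1) x,
    by rw [d_contract, LinearMap.mem_ker.1 hx, map_zero, sub_zero]⟩

end Bar

section Homology

open CategoryTheory HomologicalComplex

section Complex

variable {k : Type u} [CommRing k] {α : Type*} {c : ComplexShape α}
  (K : HomologicalComplex (ModuleCat.{w} k) c) (i : α)

theorem range_iCycles :
    LinearMap.range (K.iCycles i).hom = LinearMap.ker (K.d i (c.next i)).hom :=
  (ShortComplex.exact_of_f_is_kernel
    (ShortComplex.mk (K.iCycles i) (K.d i (c.next i)) (K.iCycles_d i (c.next i)))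
    (K.cyclesIsKernel i (c.next i) rfl)).moduleCat_range_eq_ker

theorem ker_homologyπ :
    LinearMap.ker (K.homologyπ i).hom = LinearMap.range (K.toCycles (c.prev i) i).hom :=
  (ShortComplex.exact_of_g_is_cokernel
    (ShortComplex.mk (K.toCycles (c.prev i) i) (K.homologyπ i)
      (K.toCycles_comp_homologyπ (c.prev i) i))
    (K.homologyIsCokernel (c.prev i) i rfl)).moduleCat_range_eq_ker.symm

theorem iCycles_toCycles_apply (j : α) (y : K.X j) :
    (K.iCycles i).hom ((K.toCycles j i).hom y) = (K.d j i).hom y :=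
  LinearMap.congr_fun (congrArg ModuleCat.Hom.hom (K.toCycles_i j i)) y

theorem iCycles_injective : Function.Injective (K.iCycles i).hom :=
  (ModuleCat.mono_iff_injective (K.iCycles i)).1 inferInstance

theorem homologyπ_surjective : Function.Surjective (K.homologyπ i).hom :=
  (ModuleCat.epi_iff_surjective (K.homologyπ i)).1 inferInstance

theorem isInternal_homology {ι : Type*} [DecidableEq ι] [AddMonoid ι] [IsRightCancelAdd ι]
    {𝒦 : ∀ i, ι → Submodule k (K.X i)} (h𝒦 : ∀ i, IsInternal (𝒦 i))
    (hd : ∀ i j, HasDegree (K.d i j).hom 0 (𝒦 i) (𝒦 j)) :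
    IsInternal fun j => ((𝒦 i j).comap (K.iCycles i).hom).map (K.homologyπ i).hom := by
  have (i : α) := (h𝒦 i).chooseDecomposition
  have hd_decompose : ∀ i i' x j,
      (K.d i i').hom (decompose (𝒦 i) x j) = decompose (𝒦 i') ((K.d i i').hom x) j :=
    fun i i' x j => by rw [(hd i i').map_decompose, add_zero]
  have hcycles : IsInternal fun j => (𝒦 i j).comap (K.iCycles i).hom := by
    refine isInternal_comap (iCycles_injective K i) fun z j => ?_
    have hz : (K.d i (c.next i)).hom ((K.iCycles i).hom z) = 0 := by
      rw [← LinearMap.mem_ker, ← range_iCycles]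
      exact ⟨z, rfl⟩
    rw [range_iCycles, LinearMap.mem_ker, hd_decompose, hz, decompose_zero, DirectSum.zero_apply,
      ZeroMemClass.coe_zero]
  have := hcycles.chooseDecomposition
  have hdeg : HasDegree (K.iCycles i).hom 0 (fun j => (𝒦 i j).comap (K.iCycles i).hom) (𝒦 i) :=
    fun j z hz => by rwa [add_zero]
  refine isInternal_map (homologyπ_surjective K i) fun z hz j => ?_
  obtain ⟨y, rfl⟩ := (ker_homologyπ K i).le hz
  rw [← LinearMap.mem_ker, ker_homologyπ]
  refine ⟨decompose (𝒦 (c.prev i)) y j, iCycles_injective K i ?_⟩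
  rw [hdeg.map_decompose, add_zero, iCycles_toCycles_apply, iCycles_toCycles_apply, hd_decompose]

end Complex

variable {k : Type u} [Field k] {R M : Type w} [Ring R] [Algebra k R] [AddCommGroup M]
  [Module k M] [Module Rᵐᵒᵖ M] [IsScalarTower k Rᵐᵒᵖ M]

namespace Bar

theorem complex_d_hom (ε : R →ₐ[k] k) (n : ℕ) :
    ((Bar.complex M ε).d (n + 1) n).hom = Bar.d M ε n :=
  congrArg ModuleCat.Hom.hom (ChainComplex.of_d (Obj k R M) (fun n => ModuleCat.ofHom (d M ε n)) n)

theorem iCycles_mem_cycles (ε : R →ₐ[k] k) (i : ℕ) (z : (Bar.complex M ε).cycles i) :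
    ((Bar.complex M ε).iCycles i).hom z ∈ cycles (k := k) M ε i := by
  cases i with
  | zero => trivial
  | succ i =>
    have hz : ((Bar.complex M ε).d (i + 1) i).hom (((Bar.complex M ε).iCycles (i + 1)).hom z) = 0 :=
      LinearMap.congr_fun
        (congrArg ModuleCat.Hom.hom ((Bar.complex M ε).iCycles_d (i + 1) i)) z
    rwa [complex_d_hom] at hz

end Bar

variable {ε : R →ₐ[k] k} {𝒜 : ℕ → Submodule k R} {ℳ : ℕ → Submodule k M}

theorem isInternal_algHomologyDeg [Decomposition 𝒜] [Decomposition ℳ] [SetLike.GradedMul 𝒜]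
    (hε : ∀ n, 0 < n → ∀ r ∈ 𝒜 n, ε r = 0) (hℳ : Bar.IsGradedRightSMul 𝒜 ℳ) (i : ℕ) :
    IsInternal (algHomologyDeg ε 𝒜 ℳ i) := by
  refine isInternal_homology (Bar.complex M ε) i (Bar.isInternal_objDeg 𝒜 ℳ) fun a b => ?_
  by_cases hab : b + 1 = a
  · subst hab
    rw [Bar.complex_d_hom]
    exact Bar.hasDegree_d hε hℳ b
  · rw [(Bar.complex M ε).shape a b hab]
    exact fun _ _ _ => zero_mem _

theorem algHomologyDeg_eq_bot {i j : ℕ} (h : Bar.VanishesAt ε 𝒜 ℳ i j) :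
    algHomologyDeg ε 𝒜 ℳ i j = ⊥ := by
  rw [eq_bot_iff]
  rintro _ ⟨z, hz, rfl⟩
  obtain ⟨y, hy⟩ := h ⟨hz, Bar.iCycles_mem_cycles ε i z⟩
  have hyz : ((Bar.complex M ε).toCycles (i + 1) i).hom y = z :=
    iCycles_injective (Bar.complex M ε) i <|
      (iCycles_toCycles_apply (Bar.complex M ε) i (i + 1) y).trans <|
        (LinearMap.congr_fun (Bar.complex_d_hom ε i) y).trans hy
  rw [Submodule.mem_bot, ← hyz]
  exact LinearMap.congr_fun (congrArg ModuleCat.Hom.hom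
    ((Bar.complex M ε).toCycles_comp_homologyπ (i + 1) i)) y

end Homology

section CyclicModules

variable {k : Type u} [Field k] {A : Type w} [Ring A] [Algebra k A]

/-- The grading of the cyclic right module `A / I` induced by a grading of `A`. -/
def quotDeg (𝒜 : ℕ → Submodule k A) (I : Submodule Aᵐᵒᵖ A) (n : ℕ) : Submodule k (A ⧸ I) :=
  (𝒜 n).map (I.mkQ.restrictScalars k)

/-- The colon ideal `(J : x) = {r | x r ∈ J}` of a right ideal `J`. -/
def rightColon (J : Submodule Aᵐᵒᵖ A) (x : A) : Submodule Aᵐᵒᵖ A :=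
  J.comap (LinearMap.mulLeft Aᵐᵒᵖ x)

/-- Left multiplication by `x`, as a map `A / (J : x) ⟶ A / J` of right modules. -/
def mulLeftQuot (J : Submodule Aᵐᵒᵖ A) (x : A) : (A ⧸ rightColon J x) →ₗ[Aᵐᵒᵖ] A ⧸ J :=
  (rightColon J x).mapQ J (LinearMap.mulLeft Aᵐᵒᵖ x) le_rfl

theorem mulLeftQuot_injective (J : Submodule Aᵐᵒᵖ A) (x : A) :
    Function.Injective (mulLeftQuot J x) := by
  rw [← LinearMap.ker_eq_bot]
  exact (Submodule.ker_mapQ _ _ _ _).trans (Submodule.mkQ_map_self _)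

theorem range_mulLeft_op (x : A) :
    LinearMap.range (LinearMap.mulLeft Aᵐᵒᵖ x) = Submodule.span Aᵐᵒᵖ {x} := by
  ext y
  rw [Submodule.mem_span_singleton]
  constructor
  · rintro ⟨r, rfl⟩
    exact ⟨op r, rfl⟩
  · rintro ⟨r, rfl⟩
    exact ⟨unop r, rfl⟩

theorem exact_mulLeftQuot (J : Submodule Aᵐᵒᵖ A) (x : A) :
    Function.Exact (mulLeftQuot J x)
      (Submodule.factor (le_sup_right : J ≤ Submodule.span Aᵐᵒᵖ {x} ⊔ J)) := by
  have hrange : LinearMap.range (mulLeftQuot J x) = (Submodule.span Aᵐᵒᵖ {x}).map J.mkQ :=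
    (Submodule.range_mapQ _ _ _ _).trans (congrArg _ (range_mulLeft_op x))
  have hker := Submodule.ker_mapQ J (Submodule.span Aᵐᵒᵖ {x} ⊔ J) LinearMap.id le_sup_right
  rw [Submodule.comap_id, Submodule.map_sup, Submodule.mkQ_map_self, sup_bot_eq] at hker
  exact LinearMap.exact_iff.2 (hker.trans hrange.symm)

variable {ε : A →ₐ[k] k} {𝒜 : ℕ → Submodule k A}

theorem isInternal_quotDeg [Decomposition 𝒜] {I : Submodule Aᵐᵒᵖ A} (hI : I.IsHomogeneous 𝒜) :
    IsInternal (quotDeg 𝒜 I) :=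
  isInternal_map (f := I.mkQ.restrictScalars k) I.mkQ_surjective fun _ hr j =>
    (Submodule.Quotient.mk_eq_zero I).2 (hI j ((Submodule.Quotient.mk_eq_zero I).1 hr))

theorem isGradedRightSMul_quotDeg [SetLike.GradedMul 𝒜] (I : Submodule Aᵐᵒᵖ A) :
    Bar.IsGradedRightSMul 𝒜 (quotDeg 𝒜 I) := by
  rintro i j _ ⟨s, hs, rfl⟩ r hr
  exact ⟨s * r, SetLike.mul_mem_graded hs hr, rfl⟩

theorem hasDegree_mulLeftQuot [SetLike.GradedMul 𝒜] (J : Submodule Aᵐᵒᵖ A) {n : ℕ} {x : A}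
    (hx : x ∈ 𝒜 n) :
    HasDegree ((mulLeftQuot J x).restrictScalars k) n (quotDeg 𝒜 (rightColon J x))
      (quotDeg 𝒜 J) := by
  rintro j _ ⟨r, hr, rfl⟩
  exact ⟨x * r, add_comm n j ▸ SetLike.mul_mem_graded hx hr, rfl⟩

theorem isHomogeneous_span_singleton_sup [Decomposition 𝒜] [SetLike.GradedMul 𝒜] {n : ℕ} {x : A}
    (hx : x ∈ 𝒜 n) {J : Submodule Aᵐᵒᵖ A} (hJ : J.IsHomogeneous 𝒜) :
    (Submodule.span Aᵐᵒᵖ {x} ⊔ J).IsHomogeneous 𝒜 := by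
  have hmul : HasDegree (LinearMap.mulLeft k x) n 𝒜 𝒜 := fun j r hr =>
    add_comm n j ▸ SetLike.mul_mem_graded hx hr
  intro j a ha
  obtain ⟨y, hy, z, hz, rfl⟩ := Submodule.mem_sup.1 ha
  obtain ⟨r, rfl⟩ := (range_mulLeft_op x).ge hy
  rw [decompose_add, DirectSum.add_apply, Submodule.coe_add]
  refine Submodule.add_mem_sup ?_ (hJ j hz)
  rw [← range_mulLeft_op]
  by_cases hj : ∃ i, i + n = j
  · obtain ⟨i, rfl⟩ := hj
    exact ⟨decompose 𝒜 r i, hmul.map_decompose r i⟩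
  · push Not at hj
    exact ⟨0, (map_zero _).trans (hmul.decompose_map_eq_zero hj r).symm⟩

theorem vanishesAt_quotDeg_zero (hε : ∀ n, 0 < n → ∀ r ∈ 𝒜 n, ε r = 0) (I : Submodule Aᵐᵒᵖ A)
    {j : ℕ} (hj : 0 < j) : Bar.VanishesAt ε 𝒜 (quotDeg 𝒜 I) 0 j := by
  rintro _ ⟨⟨r, hr, rfl⟩, -⟩
  let one : Bar.Obj k A (A ⧸ I) 0 := I.mkQ 1
  refine ⟨Bar.tmul k A (A ⧸ I) 0 one r, ?_⟩
  rw [Bar.d, LinearMap.add_apply, LinearMap.smul_apply, Bar.augLast_tmul, hε j hj r hr, zero_smul,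
    smul_zero, add_zero, Bar.resD_zero_tmul]
  exact congrArg I.mkQ (one_mul r)

theorem vanishesAt_quotDeg_span_singleton_sup [Decomposition 𝒜] [SetLike.GradedMul 𝒜]
    (hε : ∀ n, 0 < n → ∀ r ∈ 𝒜 n, ε r = 0) {n : ℕ} {x : A} (hx : x ∈ 𝒜 n)
    {J : Submodule Aᵐᵒᵖ A} (hJ : J.IsHomogeneous 𝒜) (hcolon : (rightColon J x).IsHomogeneous 𝒜)
    {i j : ℕ} (h : Bar.VanishesAt ε 𝒜 (quotDeg 𝒜 J) (i + 1) j)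
    (h' : ∀ l, l + n = j → Bar.VanishesAt ε 𝒜 (quotDeg 𝒜 (rightColon J x)) i l) :
    Bar.VanishesAt ε 𝒜 (quotDeg 𝒜 (Submodule.span Aᵐᵒᵖ {x} ⊔ J)) (i + 1) j := by
  have := (isInternal_quotDeg hJ).chooseDecomposition
  have := (isInternal_quotDeg hcolon).chooseDecomposition
  refine h.of_shortExact hε (isGradedRightSMul_quotDeg _) (isGradedRightSMul_quotDeg J)
    (mulLeftQuot_injective J x) (Submodule.factor_surjective le_sup_right)
    (exact_mulLeftQuot J x) (hasDegree_mulLeftQuot J hx) ?_ h'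
  rintro l _ ⟨r, hr, rfl⟩
  exact ⟨J.mkQ r, ⟨r, hr, rfl⟩, rfl⟩

end CyclicModules

/-- A Koszul filtration of a graded algebra: a family of right ideals generated by elements of
degree `1`, in which every nonzero ideal is obtained from a smaller one by adding a single linear
generator, with a colon ideal that is again in the family. -/
def IsKoszulFiltration {k A : Type*} [Field k] [Ring A] [Algebra k A] (𝒜 : ℕ → Submodule k A)
    (F : Set (Submodule Aᵐᵒᵖ A)) : Prop :=
  ∀ I ∈ F, I ≠ ⊥ → ∃ J ∈ F, ∃ x ∈ 𝒜 1, x ∉ J ∧ I = Submodule.span Aᵐᵒᵖ {x} ⊔ J ∧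
    rightColon J x ∈ F

namespace IsKoszulFiltration

section Induction

variable {k A : Type*} [Field k] [Ring A] [Algebra k A] {𝒜 : ℕ → Submodule k A}
  {F : Set (Submodule Aᵐᵒᵖ A)}

theorem induction [Module.Finite k (𝒜 1)] (hF : IsKoszulFiltration 𝒜 F)
    {motive : Submodule Aᵐᵒᵖ A → Prop} (bot : motive ⊥)
    (step : ∀ J ∈ F, ∀ x ∈ 𝒜 1, rightColon J x ∈ F → motive J →
      motive (Submodule.span Aᵐᵒᵖ {x} ⊔ J))
    {I : Submodule Aᵐᵒᵖ A} (hI : I ∈ F) : motive I := by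
  let linearPart (I : Submodule Aᵐᵒᵖ A) : Submodule k A := I.restrictScalars k ⊓ 𝒜 1
  induction hn : Module.finrank k (linearPart I) using Nat.strong_induction_on generalizing I with
  | _ n ih =>
    by_cases hbot : I = ⊥
    · exact hbot ▸ bot
    obtain ⟨J, hJ, x, hx, hxJ, rfl, hcolon⟩ := hF I hI hbot
    refine step J hJ x hx hcolon (ih _ ?_ hJ rfl)
    have : Module.Finite k (linearPart (Submodule.span Aᵐᵒᵖ {x} ⊔ J)) :=
      Submodule.finiteDimensional_of_le inf_le_right
    rw [← hn]
    refine Submodule.finrank_lt_finrank_of_lt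
      (lt_of_le_of_ne (inf_le_inf_right _ fun y hy => Submodule.mem_sup_right hy) fun h => hxJ ?_)
    exact (h.ge ⟨Submodule.mem_sup_left (Submodule.mem_span_singleton_self x), hx⟩).1

theorem isHomogeneous [Decomposition 𝒜] [SetLike.GradedMul 𝒜] [Module.Finite k (𝒜 1)]
    (hF : IsKoszulFiltration 𝒜 F) {I : Submodule Aᵐᵒᵖ A} (hI : I ∈ F) : I.IsHomogeneous 𝒜 := by
  refine hF.induction (motive := fun I => I.IsHomogeneous 𝒜) ?_
    (fun J _ x hx _ hJ => isHomogeneous_span_singleton_sup hx hJ) hI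
  rintro j r rfl
  rw [decompose_zero]
  exact zero_mem _

end Induction

variable {k : Type u} [Field k] {A : Type w} [Ring A] [Algebra k A] {ε : A →ₐ[k] k}
  {𝒜 : ℕ → Submodule k A} {F : Set (Submodule Aᵐᵒᵖ A)}

theorem vanishesAt [Decomposition 𝒜] [SetLike.GradedMul 𝒜] [Module.Finite k (𝒜 1)]
    (hF : IsKoszulFiltration 𝒜 F) (hε : ∀ n, 0 < n → ∀ r ∈ 𝒜 n, ε r = 0) {i j : ℕ} (hij : j ≠ i)
    {I : Submodule Aᵐᵒᵖ A} (hI : I ∈ F) : Bar.VanishesAt ε 𝒜 (quotDeg 𝒜 I) i j := by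
  induction i generalizing j I with
  | zero => exact vanishesAt_quotDeg_zero hε I (Nat.pos_of_ne_zero hij)
  | succ i ih =>
    refine hF.induction (motive := fun I => Bar.VanishesAt ε 𝒜 (quotDeg 𝒜 I) (i + 1) j) ?_
      (fun J hJ x hx hcolon h => ?_) hI
    · exact Bar.vanishesAt_succ_of_equiv (Submodule.quotEquivOfEqBot ⊥ rfl) ε 𝒜 _ i j
    · refine vanishesAt_quotDeg_span_singleton_sup hε hx (hF.isHomogeneous hJ)
        (hF.isHomogeneous hcolon) h fun l hl => ih ?_ hcolon
      rintro rfl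
      exact hij hl.symm

theorem isKoszulModule (hF : IsKoszulFiltration 𝒜 F) (hA : IsStandardGraded ε 𝒜)
    {I : Submodule Aᵐᵒᵖ A} (hI : I ∈ F) : IsKoszulModule ε 𝒜 (quotDeg 𝒜 I) 0 := by
  have := hA.graded
  have := hA.finite
  have := hA.internal.chooseDecomposition
  have hinternal := isInternal_quotDeg (hF.isHomogeneous hI)
  have := hinternal.chooseDecomposition
  have hsmul := isGradedRightSMul_quotDeg (𝒜 := 𝒜) I
  exact
    { standard := hA
      graded := ⟨hinternal, hsmul, fun n => inferInstanceAs (Module.Finite k ((𝒜 n).map _))⟩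
      internal := isInternal_algHomologyDeg hA.aug_eq_zero hsmul
      concentrated := fun i j hj => algHomologyDeg_eq_bot (hF.vanishesAt hA.aug_eq_zero hj hI) }

end IsKoszulFiltration

namespace SkewMonomial

section Coefficients

variable {k : Type*} [Field k] {ι : Type*} [LinearOrder ι] [Fintype ι] (q : ι → ι → k)

/-- The scalar `c` with `xᵢ xᵃ = c xᵃ⁺ᵉⁱ` for ordered monomials in variables subject to
`xᵢ xⱼ = q i j xⱼ xᵢ`. -/
def skewCoeff (i : ι) (a : ι → ℕ) : k := ∏ j with j < i, q i j ^ a j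

open Classical in
/-- Left multiplication by the variable `xᵢ` on the space with basis all the monomials.
When `q i i ≠ 1` the relations force `xᵢ² = 0`; the monomials divisible by such a square stay in
the basis, and `xᵢ` kills every monomial that it divides. -/
def mulVar (i : ι) : ((ι → ℕ) →₀ k) →ₗ[k] ((ι → ℕ) →₀ k) :=
  Finsupp.linearCombination k fun a =>
    if q i i ≠ 1 ∧ 0 < a i then 0 else Finsupp.single (a + Pi.single i 1) (skewCoeff q i a)

variable {q}

theorem skewCoeff_ne_zero (hq : ∀ i j, q i j * q j i = 1) (i : ι) (a : ι → ℕ) :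
    skewCoeff q i a ≠ 0 :=
  Finset.prod_ne_zero_iff.2 fun j _ => pow_ne_zero _ (left_ne_zero_of_mul_eq_one (hq i j))

theorem skewCoeff_add_single (i j : ι) (a : ι → ℕ) :
    skewCoeff q i (a + Pi.single j 1) = (if j < i then q i j else 1) * skewCoeff q i a := by
  simp only [skewCoeff, Pi.add_apply, pow_add, Finset.prod_mul_distrib, mul_comm, Pi.single_apply,
    pow_ite, pow_one, pow_zero, Finset.prod_ite_eq', Finset.mem_filter, Finset.mem_univ, true_and]

theorem skewCoeff_comm (hq : ∀ i j, q i j * q j i = 1) {i j : ι} (hij : i ≠ j) (a : ι → ℕ) :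
    skewCoeff q j a * skewCoeff q i (a + Pi.single j 1) =
      q i j * (skewCoeff q i a * skewCoeff q j (a + Pi.single i 1)) := by
  rw [skewCoeff_add_single, skewCoeff_add_single]
  rcases hij.lt_or_gt with h | h
  · rw [if_neg h.not_gt, if_pos h]
    linear_combination -(skewCoeff q i a * skewCoeff q j a) * hq i j
  · rw [if_pos h, if_neg h.not_gt]
    ring

theorem mulVar_single_of_dvd {i : ι} {a : ι → ℕ} (h : q i i ≠ 1 ∧ 0 < a i) (c : k) :
    mulVar q i (Finsupp.single a c) = 0 := by
  rw [mulVar, Finsupp.linearCombination_single, if_pos h, smul_zero]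

theorem mulVar_single {i : ι} {a : ι → ℕ} (h : ¬(q i i ≠ 1 ∧ 0 < a i)) (c : k) :
    mulVar q i (Finsupp.single a c) = Finsupp.single (a + Pi.single i 1) (c * skewCoeff q i a) := by
  rw [mulVar, Finsupp.linearCombination_single, if_neg h, Finsupp.smul_single, smul_eq_mul]

theorem mulVar_apply_add_single {i : ι} {a : ι → ℕ} (h : ¬(q i i ≠ 1 ∧ 0 < a i))
    (v : (ι → ℕ) →₀ k) : mulVar q i v (a + Pi.single i 1) = v a * skewCoeff q i a := by
  induction v using Finsupp.induction_linear with
  | zero => simp only [map_zero, Finsupp.zero_apply, zero_mul]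
  | add v w hv hw =>
    rw [map_add (mulVar q i), Finsupp.add_apply, hv, hw, Finsupp.add_apply, add_mul]
  | single b c =>
    by_cases hb : b = a
    · subst hb
      rw [mulVar_single h, Finsupp.single_eq_same, Finsupp.single_eq_same]
    · rw [Finsupp.single_eq_of_ne (Ne.symm hb), zero_mul]
      by_cases h' : q i i ≠ 1 ∧ 0 < b i
      · rw [mulVar_single_of_dvd h', Finsupp.zero_apply]
      · rw [mulVar_single h', Finsupp.single_eq_of_ne fun e => hb (add_right_cancel e).symm]

theorem mulVar_mulVar_self {i : ι} (hi : q i i ≠ 1) (v : (ι → ℕ) →₀ k) :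
    mulVar q i (mulVar q i v) = 0 := by
  induction v using Finsupp.induction_linear with
  | zero => rw [map_zero, map_zero]
  | add v w hv hw => rw [map_add, map_add, hv, hw, add_zero]
  | single a c =>
    by_cases h : q i i ≠ 1 ∧ 0 < a i
    · rw [mulVar_single_of_dvd h, map_zero]
    · rw [mulVar_single h, mulVar_single_of_dvd ⟨hi, by simp⟩]

theorem mulVar_comm (hq : ∀ i j, q i j * q j i = 1) (i j : ι) :
    mulVar q i * mulVar q j = q i j • (mulVar q j * mulVar q i) := by
  refine Finsupp.lhom_ext fun a c => ?_
  rw [LinearMap.smul_apply, Module.End.mul_apply, Module.End.mul_apply]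
  obtain rfl | hij := eq_or_ne i j
  · by_cases hi : q i i = 1
    · rw [hi, one_smul]
    · rw [mulVar_mulVar_self hi, smul_zero]
  have hi : (a + Pi.single j 1 : ι → ℕ) i = a i := by
    rw [Pi.add_apply, Pi.single_eq_of_ne hij, add_zero]
  have hj : (a + Pi.single i 1 : ι → ℕ) j = a j := by
    rw [Pi.add_apply, Pi.single_eq_of_ne hij.symm, add_zero]
  by_cases h : q i i ≠ 1 ∧ 0 < a i <;> by_cases h' : q j j ≠ 1 ∧ 0 < a j
  · rw [mulVar_single_of_dvd h, mulVar_single_of_dvd h', map_zero, map_zero, smul_zero]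
  · rw [mulVar_single_of_dvd h, mulVar_single h', mulVar_single_of_dvd (by rwa [hi]), map_zero,
      smul_zero]
  · rw [mulVar_single_of_dvd h', mulVar_single h, mulVar_single_of_dvd (by rwa [hj]), map_zero,
      smul_zero]
  · rw [mulVar_single h, mulVar_single h', mulVar_single (by rwa [hi]), mulVar_single (by rwa [hj]),
      Finsupp.smul_single, add_right_comm, smul_eq_mul, mul_assoc, mul_assoc,
      skewCoeff_comm hq hij, mul_left_comm]

end Coefficients

section Relations

variable {k : Type*} [Field k] {ι : Type*} {q : ι → ι → k} {A : Type*} [Ring A] [Algebra k A]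
  {x : ι → A}

theorem var_mul_pow (hx : ∀ i j, x i * x j = q i j • (x j * x i)) (i j : ι) (n : ℕ) :
    x i * x j ^ n = q i j ^ n • (x j ^ n * x i) := by
  induction n with
  | zero => rw [pow_zero, pow_zero, one_smul, mul_one, one_mul]
  | succ n ih =>
    rw [pow_succ, ← mul_assoc, ih, smul_mul_assoc, mul_assoc, hx i j, mul_smul_comm, smul_smul,
      ← mul_assoc, pow_succ]

theorem var_mul_var_self (hx : ∀ i j, x i * x j = q i j • (x j * x i)) {i : ι} (hi : q i i ≠ 1) :
    x i * x i = 0 := by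
  have h : (1 - q i i) • (x i * x i) = 0 := by rw [sub_smul, one_smul, ← hx i i, sub_self]
  exact (smul_eq_zero.1 h).resolve_left (sub_ne_zero.2 hi.symm)

end Relations

section Monomials

variable {k : Type*} [Field k] {ι : Type*} [LinearOrder ι] {q : ι → ι → k}
  {A : Type*} [Ring A] [Algebra k A] {x : ι → A}

variable (x) in
/-- The product of the powers `x i ^ a i` over `i ∈ s`, in increasing order of `i`. -/
def monomial (s : Finset ι) (a : ι → ℕ) : A := (s.sort.map fun i => x i ^ a i).prod

theorem monomial_insert {s : Finset ι} {i : ι} (hi : ∀ j ∈ s, i < j) (a : ι → ℕ) :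
    monomial x (insert i s) a = x i ^ a i * monomial x s a := by
  rw [monomial, Finset.sort_insert _ (fun j hj => (hi j hj).le) fun h => (hi i h).false,
    List.map_cons, List.prod_cons, monomial]

theorem monomial_congr {s : Finset ι} {a b : ι → ℕ} (h : ∀ i ∈ s, a i = b i) :
    monomial x s a = monomial x s b :=
  congrArg List.prod (List.map_congr_left fun i hi => by rw [h i ((Finset.mem_sort _).1 hi)])

theorem monomial_zero (s : Finset ι) : monomial x s 0 = 1 :=
  List.prod_eq_one fun _ hy => by
    obtain ⟨i, -, rfl⟩ := List.mem_map.1 hy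
    exact pow_zero _

theorem var_mul_monomial_finset (hx : ∀ i j, x i * x j = q i j • (x j * x i)) {s : Finset ι}
    {i : ι} (hi : i ∈ s) (a : ι → ℕ) :
    x i * monomial x s a =
      (∏ j ∈ s with j < i, q i j ^ a j) • monomial x s (a + Pi.single i 1) := by
  induction s using Finset.induction_on_min with
  | empty => exact absurd hi (Finset.notMem_empty i)
  | insert j s hj ih =>
    rw [monomial_insert hj, monomial_insert hj, ← mul_assoc]
    obtain rfl | hi := Finset.mem_insert.1 hi
    · have hs : (insert i s).filter (· < i) = ∅ := Finset.filter_eq_empty_iff.2 fun l hl =>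
        ((Finset.mem_insert.1 hl).elim ge_of_eq fun h => (hj l h).le).not_gt
      rw [hs, Finset.prod_empty, one_smul, Pi.add_apply, Pi.single_eq_same, ← pow_succ']
      congr 1
      refine monomial_congr fun l hl => ?_
      rw [Pi.add_apply, Pi.single_eq_of_ne (hj l hl).ne', add_zero]
    · have hji := hj i hi
      rw [Finset.filter_insert, if_pos hji, Finset.prod_insert fun h =>
        (hj j (Finset.mem_filter.1 h).1).false, var_mul_pow hx, smul_mul_assoc, mul_assoc, ih hi,
        mul_smul_comm, smul_smul, Pi.add_apply, Pi.single_eq_of_ne hji.ne, add_zero]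

theorem var_mul_monomial [Fintype ι] (hx : ∀ i j, x i * x j = q i j • (x j * x i)) (i : ι)
    (a : ι → ℕ) :
    x i * monomial x Finset.univ a = skewCoeff q i a • monomial x Finset.univ (a + Pi.single i 1) :=
  var_mul_monomial_finset hx (Finset.mem_univ i) a

theorem var_mul_monomial_of_dvd [Fintype ι] (hx : ∀ i j, x i * x j = q i j • (x j * x i)) {i : ι}
    (hi : q i i ≠ 1) {a : ι → ℕ} (ha : 0 < a i) : x i * monomial x Finset.univ a = 0 := by
  rw [var_mul_monomial hx]
  refine smul_eq_zero_of_right _ (List.prod_eq_zero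
    (List.mem_map.2 ⟨i, (Finset.mem_sort _).2 (Finset.mem_univ i), ?_⟩))
  obtain ⟨n, hn⟩ := Nat.exists_eq_add_of_lt ha
  rw [Pi.add_apply, Pi.single_eq_same, hn, zero_add, pow_succ, pow_succ, mul_assoc,
    var_mul_var_self hx hi, mul_zero]

end Monomials

section Action

variable {k : Type*} [Field k] {ι A : Type*} [Ring A] [Algebra k A]
  {Φ : A →ₐ[k] Module.End k ((ι → ℕ) →₀ k)}

variable (Φ) in
/-- The coefficients of an element of `A` in the basis of monomials, read off its action on the
monomial `1`. -/
def coeffs : A →ₗ[k] ((ι → ℕ) →₀ k) := Φ.toLinearMap.flip (Finsupp.single 0 1)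

theorem coeffs_mul (r s : A) : coeffs Φ (r * s) = Φ r (coeffs Φ s) :=
  DFunLike.congr_fun (map_mul Φ r s) _

end Action

end SkewMonomial

open SkewMonomial

/-- `A` is the algebra generated by variables `x i` subject to `x i * x j = q i j • (x j * x i)`.
That there are no further relations is encoded by the action `Φ` of `A` on the space of
monomials. -/
structure IsSkewPolynomial {k : Type*} [Field k] {ι : Type*} [LinearOrder ι] [Fintype ι]
    (q : ι → ι → k) {A : Type*} [Ring A] [Algebra k A] (x : ι → A)
    (Φ : A →ₐ[k] Module.End k ((ι → ℕ) →₀ k)) : Prop where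
  q_mul : ∀ i j, q i j * q j i = 1
  var_mul_var : ∀ i j, x i * x j = q i j • (x j * x i)
  adjoin : Algebra.adjoin k (Set.range x) = ⊤
  action_var : ∀ i, Φ (x i) = mulVar q i

namespace IsSkewPolynomial

variable {k : Type*} [Field k] {ι : Type*} [LinearOrder ι] [Fintype ι] {q : ι → ι → k}
  {A : Type*} [Ring A] [Algebra k A] {x : ι → A} {Φ : A →ₐ[k] Module.End k ((ι → ℕ) →₀ k)}

variable (k x) in
/-- The combination of ordered monomials with given coefficients. -/
def ofCoeffs : ((ι → ℕ) →₀ k) →ₗ[k] A := Finsupp.linearCombination k (monomial x Finset.univ)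

theorem ofCoeffs_mulVar (H : IsSkewPolynomial q x Φ) (i : ι) (v : (ι → ℕ) →₀ k) :
    ofCoeffs k x (mulVar q i v) = x i * ofCoeffs k x v := by
  induction v using Finsupp.induction_linear with
  | zero => rw [map_zero, map_zero, mul_zero]
  | add v w hv hw => rw [map_add, map_add, hv, hw, map_add, mul_add]
  | single a c =>
    rw [ofCoeffs, Finsupp.linearCombination_single, mul_smul_comm]
    by_cases h : q i i ≠ 1 ∧ 0 < a i
    · rw [mulVar_single_of_dvd h, map_zero, var_mul_monomial_of_dvd H.var_mul_var h.1 h.2,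
        smul_zero]
    · rw [mulVar_single h, Finsupp.linearCombination_single, var_mul_monomial H.var_mul_var,
        smul_smul]

theorem ofCoeffs_action (H : IsSkewPolynomial q x Φ) (r : A) (v : (ι → ℕ) →₀ k) :
    ofCoeffs k x (Φ r v) = r * ofCoeffs k x v := by
  have hr : r ∈ Algebra.adjoin k (Set.range x) := H.adjoin ▸ Algebra.mem_top
  induction hr using Algebra.adjoin_induction generalizing v with
  | mem y hy =>
    obtain ⟨i, rfl⟩ := hy
    rw [H.action_var, H.ofCoeffs_mulVar]
  | algebraMap c =>
    rw [AlgHom.commutes, Module.algebraMap_end_apply, map_smul, Algebra.smul_def]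
  | add y z _ _ hy hz => rw [map_add, LinearMap.add_apply, map_add, hy, hz, add_mul]
  | mul y z _ _ hy hz => rw [map_mul, Module.End.mul_apply, hy, hz, mul_assoc]

theorem ofCoeffs_coeffs (H : IsSkewPolynomial q x Φ) (r : A) : ofCoeffs k x (coeffs Φ r) = r := by
  change ofCoeffs k x (Φ r (Finsupp.single 0 1)) = r
  rw [H.ofCoeffs_action, ofCoeffs, Finsupp.linearCombination_single, one_smul, monomial_zero,
    mul_one]

/-- The coefficient vectors supported on the monomials divisible by some `x s` with `s ∈ S`. -/
def supportedOn (k : Type*) [Field k] {ι : Type*} (S : Set ι) : Submodule k ((ι → ℕ) →₀ k) :=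
  Finsupp.supported k k {a | ∃ s ∈ S, 0 < a s}

theorem mulVar_mem_supportedOn {S : Set ι} {i : ι} (hi : i ∈ S) (v : (ι → ℕ) →₀ k) :
    mulVar q i v ∈ supportedOn k S := by
  induction v using Finsupp.induction_linear with
  | zero => rw [map_zero]; exact zero_mem _
  | add v w hv hw => rw [map_add]; exact add_mem hv hw
  | single a c =>
    by_cases h : q i i ≠ 1 ∧ 0 < a i
    · rw [mulVar_single_of_dvd h]; exact zero_mem _
    · rw [mulVar_single h]
      exact Finsupp.single_mem_supported k _ ⟨i, hi, by simp⟩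

theorem action_mem_supportedOn (H : IsSkewPolynomial q x Φ) {S : Set ι} {r : A}
    (hr : r ∈ Submodule.span Aᵐᵒᵖ (x '' S)) (v : (ι → ℕ) →₀ k) : Φ r v ∈ supportedOn k S := by
  induction hr using Submodule.span_induction generalizing v with
  | mem y hy =>
    obtain ⟨i, hi, rfl⟩ := hy
    rw [H.action_var]
    exact mulVar_mem_supportedOn hi v
  | zero => rw [map_zero]; exact zero_mem _
  | add y z _ _ hy hz => rw [map_add]; exact add_mem (hy v) (hz v)
  | smul b y _ hy =>
    rw [← op_unop b, op_smul_eq_mul, map_mul]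
    exact hy _

theorem monomial_mem_span (H : IsSkewPolynomial q x Φ) {S : Set ι} {i : ι} (hi : i ∈ S)
    {a : ι → ℕ} (ha : 0 < a i) :
    monomial x Finset.univ a ∈ Submodule.span Aᵐᵒᵖ (x '' S) := by
  have hsub : a - Pi.single i 1 + Pi.single i 1 = a := by
    refine tsub_add_cancel_of_le fun j => ?_
    obtain rfl | hj := eq_or_ne j i
    · rwa [Pi.single_eq_same]
    · rw [Pi.single_eq_of_ne hj]
      exact Nat.zero_le _
  have hmul := var_mul_monomial H.var_mul_var i (a - Pi.single i 1)
  rw [hsub] at hmul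
  rw [← inv_smul_smul₀ (skewCoeff_ne_zero H.q_mul i (a - Pi.single i 1))
    (monomial x Finset.univ a), ← hmul]
  exact Submodule.smul_of_tower_mem _ _
    (Submodule.smul_mem _ (op _) (Submodule.subset_span ⟨i, hi, rfl⟩))

theorem mem_span_iff_coeffs_mem (H : IsSkewPolynomial q x Φ) {S : Set ι} {r : A} :
    r ∈ Submodule.span Aᵐᵒᵖ (x '' S) ↔ coeffs Φ r ∈ supportedOn k S := by
  refine ⟨fun hr => H.action_mem_supportedOn hr _, fun hr => ?_⟩
  rw [← H.ofCoeffs_coeffs r, ofCoeffs, Finsupp.linearCombination_apply]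
  refine sum_mem fun a ha => Submodule.smul_of_tower_mem _ _ ?_
  obtain ⟨i, hi, hai⟩ := hr ha
  exact H.monomial_mem_span hi hai

theorem var_notMem_span (H : IsSkewPolynomial q x Φ) {S : Set ι} {i : ι} (hi : i ∉ S) :
    x i ∉ Submodule.span Aᵐᵒᵖ (x '' S) := by
  intro h
  have hne : Φ (x i) (Finsupp.single 0 1) (0 + Pi.single i 1) ≠ 0 := by
    rw [H.action_var, mulVar_apply_add_single (a := 0) fun h => Nat.lt_irrefl 0 h.2,
      Finsupp.single_eq_same, one_mul]
    exact skewCoeff_ne_zero H.q_mul i 0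
  obtain ⟨s, hs, hpos⟩ := H.mem_span_iff_coeffs_mem.1 h (Finsupp.mem_support_iff.2 hne)
  rw [zero_add, Pi.single_eq_of_ne (ne_of_mem_of_not_mem hs hi)] at hpos
  exact hpos.false

theorem rightColon_span (H : IsSkewPolynomial q x Φ) {S : Set ι} {i : ι} (hi : i ∉ S) :
    rightColon (Submodule.span Aᵐᵒᵖ (x '' S)) (x i) =
      Submodule.span Aᵐᵒᵖ (x '' (S ∪ {j | j = i ∧ q i i ≠ 1})) := by
  apply le_antisymm
  · intro r hr
    refine H.mem_span_iff_coeffs_mem.2 fun a ha => ?_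
    by_cases h : q i i ≠ 1 ∧ 0 < a i
    · exact ⟨i, Or.inr ⟨rfl, h.1⟩, h.2⟩
    have hne : coeffs Φ (x i * r) (a + Pi.single i 1) ≠ 0 := by
      rw [coeffs_mul, H.action_var, mulVar_apply_add_single h]
      exact mul_ne_zero (Finsupp.mem_support_iff.1 ha) (skewCoeff_ne_zero H.q_mul i a)
    obtain ⟨s, hs, hpos⟩ := H.mem_span_iff_coeffs_mem.1 hr (Finsupp.mem_support_iff.2 hne)
    rw [Pi.add_apply, Pi.single_eq_of_ne (ne_of_mem_of_not_mem hs hi), add_zero] at hpos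
    exact ⟨s, Or.inl hs, hpos⟩
  · rw [Submodule.span_le]
    rintro _ ⟨s, hs | ⟨rfl, hs⟩, rfl⟩ <;>
      change x _ * x s ∈ Submodule.span Aᵐᵒᵖ (x '' S)
    · rw [H.var_mul_var]
      exact Submodule.smul_of_tower_mem _ _
        (Submodule.smul_mem _ (op _) (Submodule.subset_span ⟨s, hs, rfl⟩))
    · rw [var_mul_var_self H.var_mul_var hs]
      exact zero_mem _

theorem isKoszulFiltration (H : IsSkewPolynomial q x Φ) {𝒜 : ℕ → Submodule k A}
    (hx : ∀ i, x i ∈ 𝒜 1) :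
    IsKoszulFiltration 𝒜 (Set.range fun S : Set ι => Submodule.span Aᵐᵒᵖ (x '' S)) := by
  rintro _ ⟨S, rfl⟩ hS
  obtain ⟨i, hi⟩ : S.Nonempty := by
    rw [Set.nonempty_iff_ne_empty]
    rintro rfl
    exact hS (by simp only [Set.image_empty, Submodule.span_empty])
  have hnot : i ∉ S \ {i} := fun h => h.2 rfl
  refine ⟨_, ⟨S \ {i}, rfl⟩, x i, hx i, H.var_notMem_span hnot, ?_,
    ⟨_, (H.rightColon_span hnot).symm⟩⟩
  rw [← Submodule.span_union, ← Set.image_singleton, ← Set.image_union, Set.union_sdiff_self,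
    Set.union_eq_self_of_subset_left (Set.singleton_subset_iff.2 hi)]

end IsSkewPolynomial

namespace ColorLieAlgebra

variable {Γ : Type w} {k : Type u} [AddCommGroup Γ] [DecidableEq Γ] [Field k]
  {ε : CommutationFactor Γ k} {g : Type v} [AddCommGroup g] [Module k g]
  (L : ColorLieAlgebra ε g)

variable {A : Type*} [Semiring A] [Algebra k A]

/-- The universal property of `U(g)`: a linear map that respects the color commutators extends to
an algebra map. -/
def lift (f : g →ₗ[k] A)
    (hf : ∀ α β, ∀ a ∈ L.comp α, ∀ b ∈ L.comp β,
      f a * f b = (ε.toFun α β : k) • (f b * f a) + f (L.bracket a b)) : L.UEA →ₐ[k] A :=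
  RingQuot.liftAlgHom k ⟨TensorAlgebra.lift k f, by
    let := Algebra.semiringToRing k (A := A)
    rintro _ _ ⟨α, β, a, b, ha, hb⟩
    rw [map_sub, map_smul, map_mul, map_mul, sub_eq_iff_eq_add']
    simpa only [TensorAlgebra.lift_ι_apply] using hf α β a ha b hb⟩

variable {L}

theorem lift_ι {f : g →ₗ[k] A}
    (hf : ∀ α β, ∀ a ∈ L.comp α, ∀ b ∈ L.comp β,
      f a * f b = (ε.toFun α β : k) • (f b * f a) + f (L.bracket a b)) (a : g) :
    L.lift f hf (L.ι a) = f a :=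
  (RingQuot.liftAlgHom_mkAlgHom_apply k _ _ _).trans (TensorAlgebra.lift_ι_apply f a)

theorem ι_mul_ι (hL : L.IsAbelian) {α β : Γ} {a b : g} (ha : a ∈ L.comp α) (hb : b ∈ L.comp β) :
    L.ι a * L.ι b = (ε.toFun α β : k) • (L.ι b * L.ι a) := by
  have h := RingQuot.mkAlgHom_rel k (Rel.mk α β a b ha hb : L.Rel _ _)
  rw [hL a b, map_zero, map_zero, map_sub, map_smul, map_mul, map_mul] at h
  exact sub_eq_zero.1 h

variable (L) in
theorem adjoin_range_ι : Algebra.adjoin k (Set.range L.ι) = ⊤ := by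
  have h : Set.range L.ι = RingQuot.mkAlgHom k L.Rel '' Set.range (TensorAlgebra.ι k) := by
    rw [← Set.range_comp]
    rfl
  rw [h, ← AlgHom.map_adjoin, TensorAlgebra.adjoin_range_ι, Algebra.map_top, AlgHom.range_eq_top]
  exact RingQuot.mkAlgHom_surjective k L.Rel

theorem aug_ι (a : g) : L.aug (L.ι a) = 0 :=
  (RingQuot.liftAlgHom_mkAlgHom_apply k _ _ _).trans (TensorAlgebra.lift_ι_apply 0 a)

theorem aug_ueaDeg {n : ℕ} (hn : 0 < n) {r : L.UEA} (hr : r ∈ L.ueaDeg n) : L.aug r = 0 := by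
  obtain ⟨n, rfl⟩ := Nat.exists_eq_succ_of_ne_zero hn.ne'
  rw [ueaDeg, pow_succ] at hr
  refine Submodule.mul_induction_on hr ?_ fun y z hy hz => by rw [map_add, hy, hz, add_zero]
  rintro y - _ ⟨a, rfl⟩
  rw [map_mul, aug_ι, mul_zero]

theorem ι_mem_ueaDeg_one (a : g) : L.ι a ∈ L.ueaDeg 1 := by
  rw [ueaDeg, pow_one]
  exact ⟨a, rfl⟩

instance : SetLike.GradedMonoid L.ueaDeg := Submodule.nat_power_gradedMonoid _

/-- The map `U(g) → ⨁ₙ U(g)ₙ` that splits an element into its homogeneous components. -/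
def toDirectSum (hL : L.IsAbelian) : L.UEA →ₐ[k] ⨁ n, L.ueaDeg n :=
  L.lift (DirectSum.lof k ℕ (fun n => L.ueaDeg n) 1 ∘ₗ L.ι.codRestrict _ ι_mem_ueaDeg_one) <| by
    intro α β a ha b hb
    rw [hL, map_zero, add_zero]
    simp only [LinearMap.comp_apply, DirectSum.lof_eq_of, DirectSum.of_mul_of]
    rw [← DirectSum.lof_eq_of k, ← DirectSum.lof_eq_of k, ← map_smul]
    exact congrArg _ (Subtype.ext (ι_mul_ι hL ha hb))

theorem toDirectSum_ι (hL : L.IsAbelian) (a : g) :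
    toDirectSum hL (L.ι a) = DirectSum.of (fun n => L.ueaDeg n) 1 ⟨L.ι a, ι_mem_ueaDeg_one a⟩ :=
  lift_ι _ a

theorem toDirectSum_of_mem (hL : L.IsAbelian) {n : ℕ} {r : L.UEA} (hr : r ∈ L.ueaDeg n) :
    toDirectSum hL r = DirectSum.of (fun n => L.ueaDeg n) n ⟨r, hr⟩ := by
  induction hr using Submodule.pow_induction_on_left' with
  | algebraMap c => rw [AlgHom.commutes, DirectSum.algebraMap_apply]; rfl
  | add x y i hx hy ihx ihy => rw [map_add, ihx, ihy, ← map_add]; rfl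
  | mem_mul m hm i x hx ih =>
    obtain ⟨a, rfl⟩ := hm
    rw [map_mul, ih, toDirectSum_ι, DirectSum.of_mul_of]
    exact DirectSum.of_eq_of_gradedMonoid_eq (Sigma.subtype_ext (add_comm 1 i) rfl)

theorem coeAlgHom_comp_toDirectSum (hL : L.IsAbelian) :
    (DirectSum.coeAlgHom L.ueaDeg).comp (toDirectSum hL) = AlgHom.id k L.UEA := by
  refine AlgHom.ext_of_adjoin_eq_top L.adjoin_range_ι ?_
  rintro _ ⟨a, rfl⟩
  rw [AlgHom.comp_apply, toDirectSum_ι, DirectSum.coeAlgHom_of, AlgHom.id_apply]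

theorem isInternal_ueaDeg (hL : L.IsAbelian) : DirectSum.IsInternal L.ueaDeg :=
  let := GradedAlgebra.ofAlgHom L.ueaDeg (toDirectSum hL) (coeAlgHom_comp_toDirectSum hL)
    fun _ r => toDirectSum_of_mem hL r.2
  DirectSum.Decomposition.isInternal L.ueaDeg

theorem isStandardGraded (hL : L.IsAbelian) [Module.Finite k g] :
    IsStandardGraded L.aug L.ueaDeg where
  internal := isInternal_ueaDeg hL
  graded := inferInstance
  finite n := Module.Finite.iff_fg.2 (Submodule.FG.pow (Module.Finite.iff_fg.1 inferInstance) n)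
  connected := pow_zero _
  generated := by
    rw [ueaDeg, pow_one]
    exact L.adjoin_range_ι
  aug_eq_zero _ hn _ hr := aug_ueaDeg hn hr

theorem rightIdeal_eq_of_subset_span {W W' : Set g} (h : W' ⊆ W) (h' : W ⊆ Submodule.span k W') :
    L.rightIdeal W = L.rightIdeal W' := by
  refine le_antisymm (Submodule.span_le.2 ?_) (Submodule.span_mono (Set.image_mono h))
  rintro _ ⟨a, ha, rfl⟩
  have hle : Submodule.span k W' ≤ ((L.rightIdeal W').restrictScalars k).comap L.ι :=
    Submodule.span_le.2 fun c hc => Submodule.subset_span ⟨c, hc, rfl⟩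
  exact hle (h' ha)

theorem exists_homogeneous_basis {W : Set g} (hW : ∀ x ∈ W, L.IsHomogeneous x) :
    ∃ (ι : Type v) (b : Module.Basis ι k g) (γ : ι → Γ) (S : Set ι),
      (∀ i, b i ∈ L.comp (γ i)) ∧ b '' S ⊆ W ∧ W ⊆ Submodule.span k (b '' S) := by
  obtain ⟨s, hsW, -, hWs, hs⟩ := exists_linearIndepOn_id_extension
    (linearIndepOn_empty k (id : g → g)) (Set.empty_subset W)
  obtain ⟨t, ht_hom, hst, hom_t, ht⟩ := exists_linearIndepOn_id_extension hs
    (show s ⊆ {a | L.IsHomogeneous a} from fun a ha => hW a (hsW ha))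
  have htop : ⊤ ≤ Submodule.span k (Set.range (Subtype.val : t → g)) := by
    rw [Subtype.range_coe, ← L.isInternal.submodule_iSup_eq_top]
    exact iSup_le fun α a ha => hom_t ⟨α, ha⟩
  let b : Module.Basis t k g := Module.Basis.mk ht htop
  have hb (i : t) : b i = i := Module.Basis.mk_apply ht htop i
  have himage : b '' {i | (i : g) ∈ s} = s := by
    rw [funext hb]
    exact Subtype.image_preimage_coe t s ▸ Set.inter_eq_right.2 hst
  choose γ hγ using fun i : t => ht_hom i.2
  exact ⟨t, b, γ, {i | (i : g) ∈ s}, fun i => (hb i).symm ▸ hγ i, himage.symm ▸ hsW,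
    himage.symm ▸ hWs⟩

section HomogeneousBasis

variable {ι : Type*} {b : Module.Basis ι k g} {γ : ι → Γ} (hb : ∀ i, b i ∈ L.comp (γ i))
include hb

theorem comp_le_span_basis (α : Γ) : L.comp α ≤ Submodule.span k (b '' {i | γ i = α}) := by
  let := L.isInternal.chooseDecomposition
  intro a ha
  have hproj : a ∈ (Submodule.span k (Set.range b)).map (componentProj L.comp α) :=
    ⟨a, b.mem_span a, componentProj_of_mem_same ha⟩
  rw [Submodule.map_span] at hproj
  refine Submodule.span_le.2 ?_ hproj
  rintro _ ⟨_, ⟨i, rfl⟩, rfl⟩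
  obtain rfl | hi := eq_or_ne (γ i) α
  · rw [componentProj_of_mem_same (hb i)]
    exact Submodule.subset_span ⟨i, rfl, rfl⟩
  · rw [componentProj_of_mem_ne (hb i) hi]
    exact zero_mem _

theorem mul_eq_smul_mul_of_basis {f : g →ₗ[k] A}
    (hf : ∀ i j, f (b i) * f (b j) = (ε.toFun (γ i) (γ j) : k) • (f (b j) * f (b i))) {α β : Γ}
    {a c : g} (ha : a ∈ L.comp α) (hc : c ∈ L.comp β) :
    f a * f c = (ε.toFun α β : k) • (f c * f a) := by
  replace ha := comp_le_span_basis hb α ha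
  replace hc := comp_le_span_basis hb β hc
  induction ha, hc using Submodule.span_induction₂ with
  | mem_mem y z hy hz =>
    obtain ⟨i, rfl, rfl⟩ := hy
    obtain ⟨j, rfl, rfl⟩ := hz
    exact hf i j
  | zero_left z hz => rw [map_zero, zero_mul, mul_zero, smul_zero]
  | zero_right y hy => rw [map_zero, zero_mul, mul_zero, smul_zero]
  | add_left x y z _ _ _ hx hy => rw [map_add, add_mul, mul_add, smul_add, hx, hy]
  | add_right x y z _ _ _ hx hy => rw [map_add, add_mul, mul_add, smul_add, hx, hy]
  | smul_left t x y _ _ h => rw [map_smul, smul_mul_assoc, mul_smul_comm, h, smul_comm]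
  | smul_right t x y _ _ h => rw [map_smul, smul_mul_assoc, mul_smul_comm, h, smul_comm]

theorem exists_isSkewPolynomial (hL : L.IsAbelian) [LinearOrder ι] [Fintype ι] :
    ∃ Φ, IsSkewPolynomial (fun i j => (ε.toFun (γ i) (γ j) : k)) (fun i => L.ι (b i)) Φ := by
  set q : ι → ι → k := fun i j => ε.toFun (γ i) (γ j)
  have hq (i j : ι) : q i j * q j i = 1 := by
    rw [← Units.val_mul, ε.skew, Units.val_one]
  let f : g →ₗ[k] Module.End k ((ι → ℕ) →₀ k) := b.constr k (mulVar q)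
  have hf (i : ι) : f (b i) = mulVar q i := b.constr_basis k _ i
  have hcomm : ∀ α β, ∀ a ∈ L.comp α, ∀ c ∈ L.comp β,
      f a * f c = (ε.toFun α β : k) • (f c * f a) + f (L.bracket a c) := by
    intro α β a ha c hc
    rw [hL, map_zero, add_zero]
    refine mul_eq_smul_mul_of_basis hb (fun i j => ?_) ha hc
    rw [hf, hf]
    exact mulVar_comm hq i j
  refine ⟨L.lift f hcomm, hq, fun i j => ι_mul_ι hL (hb i) (hb j), ?_, fun i => ?_⟩
  · have hrange : (LinearMap.range L.ι : Set L.UEA) = Submodule.span k (Set.range (L.ι ∘ b)) := by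
      rw [Set.range_comp, ← Submodule.map_span, b.span_eq, LinearMap.range_eq_map]
    rw [← L.adjoin_range_ι, ← LinearMap.coe_range, hrange, Algebra.adjoin_span]
    rfl
  · rw [lift_ι, hf]

end HomogeneousBasis

end ColorLieAlgebra

end

theorem mainTheorem9_general {k : Type u} [Field k] {Γ : Type w} [AddCommGroup Γ] [DecidableEq Γ]
    (ε : CommutationFactor Γ k) {g : Type v} [AddCommGroup g] [Module k g] [Module.Finite k g]
    (L : ColorLieAlgebra ε g) (hL : L.IsAbelian)
    (W : Set g) (hW : ∀ x ∈ W, L.IsHomogeneous x) :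
    (∀ i : ℕ, DirectSum.IsInternal (L.homologyDeg W i) ∧
      ∀ j : ℕ, j ≠ i → L.homologyDeg W i j = ⊥) ∧
    IsKoszulModule L.aug L.ueaDeg (L.cyclicDeg W) 0 := by
  obtain ⟨ι, b, γ, S, hb, hSW, hWS⟩ := ColorLieAlgebra.exists_homogeneous_basis hW
  have := Module.Finite.finite_basis b
  let := Fintype.ofFinite ι
  let := IsWellOrder.linearOrder (WellOrderingRel (α := ι))
  obtain ⟨Φ, hskew⟩ := ColorLieAlgebra.exists_isSkewPolynomial hb hL
  have hideal : L.rightIdeal W ∈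
      Set.range fun S : Set ι => Submodule.span L.UEAᵐᵒᵖ ((fun i => L.ι (b i)) '' S) :=
    ⟨S, by rw [ColorLieAlgebra.rightIdeal_eq_of_subset_span hSW hWS,
      ColorLieAlgebra.rightIdeal, Set.image_image]⟩
  have hkoszul : IsKoszulModule L.aug L.ueaDeg (L.cyclicDeg W) 0 :=
    (hskew.isKoszulFiltration fun i => ColorLieAlgebra.ι_mem_ueaDeg_one (b i)).isKoszulModule
      (ColorLieAlgebra.isStandardGraded hL) hideal
  exact ⟨fun i => ⟨hkoszul.internal i, hkoszul.concentrated i⟩, hkoszul⟩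

theorem mainTheorem9 {k : Type u} [Field k] (h2 : (2 : k) ≠ 0) (h3 : (3 : k) ≠ 0)
    {Γ : Type w} [AddCommGroup Γ] [DecidableEq Γ] (ε : CommutationFactor Γ k)
    {g : Type v} [AddCommGroup g] [Module k g] [Module.Finite k g]
    (L : ColorLieAlgebra ε g) (hL : L.IsAbelian)
    (W : Set g) (hW : ∀ x ∈ W, L.IsHomogeneous x) :
    (∀ i : ℕ, DirectSum.IsInternal (L.homologyDeg W i) ∧
      ∀ j : ℕ, j ≠ i → L.homologyDeg W i j = ⊥) ∧
    IsKoszulModule L.aug L.ueaDeg (L.cyclicDeg W) 0 :=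
  mainTheorem9_general ε L hL W hW
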